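/- **Corollary 1.3.** Let $k \ge 1$ and $d \ge 0$ be integers, let $M$ be a $d$-dimensional $C^k$ manifold (without boundary), and let $N \subseteq M$ be a subset that is locally compact in the subspace topology. Suppose that $N$ is *$C^k$ homogeneous in $M$*: for all $p, q \in N$ there are open neighborhoods $U$ of $p$ and $V$ of $q$ in $M$ and a $C^k$ diffeomorphism $\Phi : U \to V$ with $\Phi(p) = q$ and $\Phi(U \cap N) = V \cap N$. Then $N$ is an (embedded) $C^k$ submanifold of $M$: there is an integer $0 \le m \le d$ such that every $x \in N$ lies in the domain $U$ of a chart $\varphi : U \to \varphi(U) \subseteq \mathbb{R}^d$ of the maximal $C^k$ atlas of $M$ with $$\varphi(U \cap N) = \varphi(U) \cap (\mathbb{R}^m \times \{0\}).$$ -/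

import Mathlib

open scoped Manifold ContDiff

/-- A subset `N` of a `d`-dimensional manifold `M` is `C^k` homogeneous in `M` if for any two points
`p, q ∈ N` there is a `C^k` local diffeomorphism of `M` (a `C^k` diffeomorphism `Φ` between an open
neighbourhood of `p` and an open neighbourhood of `q`) sending `p` to `q` and preserving `N`. -/
def IsCkHomogeneous (k d : ℕ) {M : Type*} [TopologicalSpace M]
    [ChartedSpace (EuclideanSpace ℝ (Fin d)) M] (N : Set M) : Prop :=
  ∀ p ∈ N, ∀ q ∈ N, ∃ Φ : OpenPartialHomeomorph M M,
    p ∈ Φ.source ∧ Φ p = q ∧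
    ContMDiffOn (𝓡 d) (𝓡 d) (k : WithTop ℕ∞) Φ Φ.source ∧
    ContMDiffOn (𝓡 d) (𝓡 d) (k : WithTop ℕ∞) Φ.symm Φ.target ∧
    Φ '' (Φ.source ∩ N) = Φ.target ∩ N

/-- The coordinate subspace `ℝ^m × {0}` of `ℝ^d` (for `m ≤ d`). -/
def coordinateSlice (d m : ℕ) : Set (EuclideanSpace ℝ (Fin d)) :=
  {v | ∀ i : Fin d, m ≤ (i : ℕ) → v i = 0}

/-- A subset `N` of a `d`-dimensional `C^k` manifold `M` is a (embedded) `C^k` submanifold if, for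
some dimension `m ≤ d`, around every point of `N` there is a chart in the maximal `C^k` atlas of `M`
that maps `N` to the slice `ℝ^m × {0}`. -/
def IsCkSubmanifold (k d : ℕ) {M : Type*} [TopologicalSpace M]
    [ChartedSpace (EuclideanSpace ℝ (Fin d)) M] (N : Set M) : Prop :=
  ∃ m : ℕ, m ≤ d ∧ ∀ x ∈ N,
    ∃ φ ∈ IsManifold.maximalAtlas (𝓡 d) (k : WithTop ℕ∞) M,
      x ∈ φ.source ∧ φ '' (φ.source ∩ N) = φ.target ∩ coordinateSlice d m

open Set Filter Topology Asymptotics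
open scoped RealInnerProductSpace

/-! By homogeneity, whatever holds for one germ of `N` holds for all, so it is enough to find one
point near which `N`, read in a chart as a locally compact set `X`, is a `C^k` graph. Germ
identifications are only asked to be mutually inverse along `X` (`GermHomogeneous`), since only this
weak form survives prolongation.

Lipschitz graph (`exists_expanding_projection`): take the least `m` for which some linear `T` to
`ℝ^m` is bounded below on differences of a relatively open piece of `X`. If the image of the piece
had empty interior, a ball would touch the image of a compact piece from outside, which forces the
tangent directions there into a half-space. Homogeneity carries this to every point, Baire makes it
uniform on an open piece, exchanging the two points makes it two-sided, and one dimension can then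
be projected away, contradicting minimality.

`C^1` (`exists_graph_one`): Rademacher gives one point of differentiability of the parametrization
`σ`, homogeneity gives all of them. Baire then gives one point of strict differentiability,
homogeneity again gives all, and strict differentiability on an open set is `C^1`.

Higher `k` (`exists_graph`): induct on `k` over all spaces at once. The set of pairs `(σ y, dσ y)`
is locally compact and homogeneous with one derivative less, hence somewhere a graph of the lower
class, perhaps over another base. The change of base is injective and open, so its derivative is
invertible somewhere (`exists_equiv_fderiv`); inverting it shows that `dσ` has the lower class, so
`σ` gains a derivative.

A shear flattens the resulting graph, and homogeneity moves this one slice chart to every point of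
`N`. -/

/-- The germs of `X ⊆ E` at any two of its points are identified by `C^k` maps of the ambient
space that are mutually inverse along `X`. -/
def GermHomogeneous {E : Type*} [NormedAddCommGroup E] [NormedSpace ℝ E] (k : ℕ)
    (X : Set E) : Prop :=
  ∀ p ∈ X, ∀ q ∈ X, ∃ Φ Ψ : E → E, ContDiffAt ℝ k Φ p ∧ ContDiffAt ℝ k Ψ q ∧ Φ p = q ∧ Ψ q = p ∧
    (∀ᶠ x in 𝓝[X] p, Φ x ∈ X ∧ Ψ (Φ x) = x) ∧ (∀ᶠ x in 𝓝[X] q, Ψ x ∈ X ∧ Φ (Ψ x) = x)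

/-! ### Touching balls and transport of tangent cones -/

section Germs

theorem exists_compact_nhdsWithin {E : Type*} [TopologicalSpace E] {X : Set E}
    [LocallyCompactSpace X] {x : E} (hx : x ∈ X) {W : Set E}
    (hW : W ∈ 𝓝 x) : ∃ K ⊆ X ∩ W, IsCompact K ∧ K ∈ 𝓝[X] x := by
  have h1 : ((↑) : X → E) ⁻¹' W ∈ 𝓝 (⟨x, hx⟩ : X) :=
    continuous_subtype_val.continuousAt.preimage_mem_nhds hW
  obtain ⟨K, hK, hKW, hKc⟩ := LocallyCompactSpace.local_compact_nhds _ _ h1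
  refine ⟨(↑) '' K, ?_, hKc.image continuous_subtype_val, ?_⟩
  · rintro _ ⟨y, hy, rfl⟩
    exact ⟨y.2, hKW hy⟩
  · rw [nhdsWithin_eq_map_subtype_coe hx]
    exact image_mem_map hK

variable {E : Type*} [NormedAddCommGroup E] [NormedSpace ℝ E] {X : Set E}

theorem GermHomogeneous.mono {k l : ℕ} (h : GermHomogeneous k X) (hl : l ≤ k) :
    GermHomogeneous l X := by
  intro p hp q hq
  obtain ⟨Φ, Ψ, h1, h2, h3⟩ := h p hp q hq
  exact ⟨Φ, Ψ, h1.of_le (by exact_mod_cast hl), h2.of_le (by exact_mod_cast hl), h3⟩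

/-- If the image of a locally compact set under a linear map that is expanding on it has empty
interior, then the image is touched by a ball from outside at some point. -/
theorem exists_touching_point [LocallyCompactSpace X] {F : Type*} [NormedAddCommGroup F]
    [InnerProductSpace ℝ F] (T : E →L[ℝ] F) {C : ℝ} {W : Set E} (hW : IsOpen W)
    (hne : (X ∩ W).Nonempty) (hT : ∀ x ∈ X ∩ W, ∀ y ∈ X ∩ W, ‖x - y‖ ≤ C * ‖T (x - y)‖)
    (hint : interior (T '' (X ∩ W)) = ∅) :
    ∃ x₁ ∈ X ∩ W, ∃ v : F, v ≠ 0 ∧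
      ∀ ε > 0, ∀ᶠ x in 𝓝[X] x₁, ⟪v, T (x - x₁)⟫ ≤ ε * ‖x - x₁‖ := by
  obtain ⟨x₀, hx₀⟩ := hne
  obtain ⟨K, hKX, hKc, hK⟩ := exists_compact_nhdsWithin hx₀.1 (hW.mem_nhds hx₀.2)
  have hx₀K : x₀ ∈ K := mem_of_mem_nhdsWithin hx₀.1 hK
  obtain ⟨ρ, hρ, hρK⟩ := Metric.mem_nhdsWithin_iff.1 hK
  -- A nearest point of `T '' K` to a `z` within `δ` of `T x₀` is within `2 * δ` of `T x₀`;
  -- expansion then keeps its preimage within `ρ` of `x₀`, where `K` is still a neighbourhood in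
  -- `X`.
  obtain ⟨δ, hδ, hCδ⟩ : ∃ δ > 0, |C| * (2 * δ) < ρ := by
    refine ⟨ρ / (2 * (|C| + 1)), by positivity, ?_⟩
    rw [show |C| * (2 * (ρ / (2 * (|C| + 1)))) = (|C| * ρ) / (|C| + 1) by field_simp,
      div_lt_iff₀ (by positivity)]
    nlinarith
  obtain ⟨z, hz, hzK⟩ : ∃ z ∈ Metric.ball (T x₀) δ, z ∉ T '' K := by
    by_contra! h
    have : T x₀ ∈ interior (T '' (X ∩ W)) :=
      mem_interior.2 ⟨_, fun z hz => image_mono hKX (h z hz), Metric.isOpen_ball,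
        Metric.mem_ball_self hδ⟩
    rw [hint] at this
    exact this
  obtain ⟨_, ⟨x₁, hx₁, rfl⟩, hd⟩ := (hKc.image T.continuous).exists_infDist_eq_dist
    ⟨_, mem_image_of_mem T hx₀K⟩ z
  have hmin : ∀ x ∈ K, dist z (T x₁) ≤ dist z (T x) := fun x hx => by
    rw [← hd]; exact Metric.infDist_le_dist_of_mem (mem_image_of_mem T hx)
  have hv : z - T x₁ ≠ 0 := fun h => hzK ⟨x₁, hx₁, (sub_eq_zero.1 h).symm⟩
  have hclose : dist x₁ x₀ < ρ := by
    have h1 := hT _ (hKX hx₁) _ (hKX hx₀K)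
    have h2 : ‖T (x₁ - x₀)‖ ≤ 2 * δ := by
      rw [map_sub, ← dist_eq_norm]
      have h3 := hmin x₀ hx₀K
      have h4 := dist_triangle_left (T x₁) (T x₀) z
      rw [Metric.mem_ball] at hz
      linarith
    rw [dist_eq_norm]
    refine lt_of_le_of_lt (h1.trans ?_) hCδ
    gcongr
    exact le_abs_self C
  have hKx₁ : K ∈ 𝓝[X] x₁ := by
    refine mem_of_superset ?_ hρK
    exact inter_mem (mem_nhdsWithin_of_mem_nhds (Metric.isOpen_ball.mem_nhds hclose))
      self_mem_nhdsWithin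
  refine ⟨x₁, hKX hx₁, z - T x₁, hv, fun ε hε => ?_⟩
  have hsmall : ∀ᶠ x in 𝓝[X] x₁, ‖T‖ * (‖T‖ * ‖x - x₁‖) ≤ 2 * ε := by
    have hc : ContinuousAt (fun x => ‖T‖ * (‖T‖ * ‖x - x₁‖)) x₁ := by fun_prop
    have := hc.eventually_le_const (u := 2 * ε) (by simpa using hε)
    exact this.filter_mono nhdsWithin_le_nhds
  filter_upwards [hsmall, hKx₁] with x hx hxK
  have h1 := hmin x hxK
  rw [dist_eq_norm, dist_eq_norm, show z - T x = (z - T x₁) - T (x - x₁) by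
    rw [map_sub]; abel] at h1
  -- Expanding the square bounds `2 * ⟪v, T (x - x₁)⟫` by `‖T (x - x₁)‖ ^ 2`, which is of second
  -- order.
  have h2 : ‖z - T x₁‖ ^ 2 ≤ ‖(z - T x₁) - T (x - x₁)‖ ^ 2 := by gcongr
  rw [norm_sub_sq_real (z - T x₁) (T (x - x₁))] at h2
  have h3 : ‖T (x - x₁)‖ ^ 2 ≤ (‖T‖ * (‖T‖ * ‖x - x₁‖)) * ‖x - x₁‖ := by
    have := T.le_opNorm (x - x₁)
    calc ‖T (x - x₁)‖ ^ 2 ≤ (‖T‖ * ‖x - x₁‖) ^ 2 := by gcongr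
      _ = _ := by ring
  have h4 := mul_le_mul_of_nonneg_right hx (norm_nonneg (x - x₁))
  linarith

/-- Transport of first order information along a germ identification. -/
theorem GermHomogeneous.transport_cone {F : Type*} [NormedAddCommGroup F]
    [InnerProductSpace ℝ F] (h : GermHomogeneous 1 X) (T : E →L[ℝ] F) {C : ℝ} {p q : E}
    (hp : p ∈ X) (hq : q ∈ X) {v : F}
    (hT : ∀ᶠ x in 𝓝[X] p, ‖x - p‖ ≤ C * ‖T (x - p)‖)
    (hv : ∀ ε > 0, ∀ᶠ x in 𝓝[X] p, ⟪v, T (x - p)⟫ ≤ ε * ‖x - p‖) :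
    ∃ (S : E →L[ℝ] F) (D : ℝ), (∀ᶠ x in 𝓝[X] q, ‖x - q‖ ≤ D * ‖S (x - q)‖) ∧
      ∀ ε > 0, ∀ᶠ x in 𝓝[X] q, ⟪v, S (x - q)⟫ ≤ ε * ‖x - q‖ := by
  obtain ⟨Φ, Ψ, h1, h2, h3, h4, h5, h6⟩ := h p hp q hq
  have hΦ := (h1.differentiableAt (by norm_num)).hasFDerivAt
  have hΨ := (h2.differentiableAt (by norm_num)).hasFDerivAt
  have htend : Tendsto Ψ (𝓝[X] q) (𝓝[X] p) :=
    tendsto_nhdsWithin_iff.2 ⟨(h4 ▸ h2.continuousAt.tendsto).mono_left nhdsWithin_le_nhds,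
      h6.mono fun x hx => hx.1⟩
  have hlin : ∀ c > 0, ∀ᶠ x in 𝓝[X] q,
      ‖(Ψ x - p) - fderiv ℝ Ψ q (x - q)‖ ≤ c * ‖x - q‖ := fun c hc => by
    have := (isLittleO_iff.1 hΨ.isLittleO hc).filter_mono (nhdsWithin_le_nhds (s := X))
    simpa only [h4] using this
  -- Along `X` the map `Φ` undoes `Ψ`, so differentiability of `Φ` at `p` bounds `Ψ` from below.
  have hO : ∃ A > 0, ∀ᶠ x in 𝓝[X] q, ‖x - q‖ ≤ A * ‖Ψ x - p‖ := by
    obtain ⟨A, hA, hA'⟩ := hΦ.isBigO_sub.exists_pos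
    refine ⟨A, hA, ?_⟩
    filter_upwards [(htend.mono_right nhdsWithin_le_nhds).eventually hA'.bound, h6] with x hx hx'
    rwa [hx'.2, h3] at hx
  have hO' : ∃ A > 0, ∀ᶠ x in 𝓝[X] q, ‖Ψ x - p‖ ≤ A * ‖x - q‖ := by
    obtain ⟨A, hA, hA'⟩ := hΨ.isBigO_sub.exists_pos
    refine ⟨A, hA, ?_⟩
    filter_upwards [hA'.bound.filter_mono (nhdsWithin_le_nhds (s := X))] with x hx
    rwa [h4] at hx
  obtain ⟨A, hA, hA'⟩ := hO
  obtain ⟨B, hB, hB'⟩ := hO'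
  have hTd : ∀ x : E, T (Ψ x - p) = T ((Ψ x - p) - fderiv ℝ Ψ q (x - q)) +
      T (fderiv ℝ Ψ q (x - q)) := fun x => by rw [← map_add]; congr 1; abel
  refine ⟨T ∘L fderiv ℝ Ψ q, 2 * A * |C|, ?_, fun ε hε => ?_⟩
  -- This tolerance makes the linearization error cost at most half of `‖x - q‖`, which is absorbed
  -- on the left and accounts for the factor `2` in the new constant.
  · have hc : 0 < 1 / (2 * A * (|C| + 1) * (‖T‖ + 1)) := by positivity
    filter_upwards [hA', hlin _ hc, htend.eventually hT] with x e1 e2 e3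
    have e4 : ‖T (Ψ x - p)‖ ≤ ‖T‖ * (1 / (2 * A * (|C| + 1) * (‖T‖ + 1)) * ‖x - q‖) +
        ‖T (fderiv ℝ Ψ q (x - q))‖ := by
      rw [hTd]
      refine (norm_add_le _ _).trans ?_
      gcongr
      exact (T.le_opNorm _).trans (by gcongr)
    have e5 : ‖Ψ x - p‖ ≤ |C| * ‖T (Ψ x - p)‖ := e3.trans (by gcongr; exact le_abs_self C)
    have e6 : A * (|C| * (‖T‖ * (1 / (2 * A * (|C| + 1) * (‖T‖ + 1)) * ‖x - q‖))) ≤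
        (1 / 2) * ‖x - q‖ := by
      have : A * (|C| * (‖T‖ * (1 / (2 * A * (|C| + 1) * (‖T‖ + 1)) * ‖x - q‖))) =
          (|C| / (|C| + 1)) * (‖T‖ / (‖T‖ + 1)) * ((1 / 2) * ‖x - q‖) := by
        field_simp
      rw [this]
      have a1 : |C| / (|C| + 1) ≤ 1 := by rw [div_le_one (by positivity)]; linarith
      have a2 : ‖T‖ / (‖T‖ + 1) ≤ 1 := by rw [div_le_one (by positivity)]; linarith
      exact mul_le_of_le_one_left (by positivity) (mul_le_one₀ a1 (by positivity) a2)
    have e7 : ‖x - q‖ ≤ A * (|C| * (‖T‖ * (1 / (2 * A * (|C| + 1) * (‖T‖ + 1)) * ‖x - q‖) +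
        ‖T (fderiv ℝ Ψ q (x - q))‖)) := by
      refine e1.trans ?_
      gcongr
      exact e5.trans (by gcongr)
    rw [mul_add, mul_add] at e7
    simp only [ContinuousLinearMap.comp_apply]
    linarith
  · have hε' : 0 < ε / (2 * B) := by positivity
    have hc : 0 < ε / (2 * (‖v‖ + 1) * (‖T‖ + 1)) := by positivity
    filter_upwards [hB', hlin _ hc, htend.eventually (hv _ hε')] with x e1 e2 e3
    have e4 : ⟪v, T ((Ψ x - p) - fderiv ℝ Ψ q (x - q))⟫ ≥ -(ε / 2 * ‖x - q‖) := by
      have b1 := neg_le_of_abs_le (abs_real_inner_le_norm v (T ((Ψ x - p) - fderiv ℝ Ψ q (x - q))))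
      have b2 : ‖v‖ * ‖T ((Ψ x - p) - fderiv ℝ Ψ q (x - q))‖ ≤
          ‖v‖ * (‖T‖ * (ε / (2 * (‖v‖ + 1) * (‖T‖ + 1)) * ‖x - q‖)) := by
        gcongr
        exact (T.le_opNorm _).trans (by gcongr)
      have b3 : ‖v‖ * (‖T‖ * (ε / (2 * (‖v‖ + 1) * (‖T‖ + 1)) * ‖x - q‖)) =
          (‖v‖ / (‖v‖ + 1)) * (‖T‖ / (‖T‖ + 1)) * (ε / 2 * ‖x - q‖) := by field_simp
      have a1 : ‖v‖ / (‖v‖ + 1) ≤ 1 := by rw [div_le_one (by positivity)]; linarith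
      have a2 : ‖T‖ / (‖T‖ + 1) ≤ 1 := by rw [div_le_one (by positivity)]; linarith
      have b4 : (‖v‖ / (‖v‖ + 1)) * (‖T‖ / (‖T‖ + 1)) * (ε / 2 * ‖x - q‖) ≤ ε / 2 * ‖x - q‖ :=
        mul_le_of_le_one_left (by positivity) (mul_le_one₀ a1 (by positivity) a2)
      linarith
    have e5 : ε / (2 * B) * ‖Ψ x - p‖ ≤ ε / 2 * ‖x - q‖ := by
      calc ε / (2 * B) * ‖Ψ x - p‖ ≤ ε / (2 * B) * (B * ‖x - q‖) := by gcongr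
        _ = _ := by field_simp
    rw [hTd, inner_add_right] at e3
    simp only [ContinuousLinearMap.comp_apply]
    linarith

end Germs

/-! ### Baire category: a Lipschitz graph of minimal dimension -/

theorem isClosed_forall_dist_lt_imp {A B : Type*} [TopologicalSpace A] [PseudoMetricSpace B]
    {f : A → B} (hf : Continuous f) (X : Set B) (r : ℝ) {R : A → B → Prop}
    (hR : ∀ x ∈ X, IsClosed {q | R q x}) :
    IsClosed {q | ∀ x ∈ X, dist x (f q) < r → R q x} := by
  simp only [Set.ofPred_forall]
  refine isClosed_biInter fun x hx => ?_
  simp only [imp_iff_not_or, not_lt, Set.ofPred_or]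
  exact (isClosed_le continuous_const (continuous_const.dist hf)).union (hR x hx)

section Baire

variable {E : Type*} [NormedAddCommGroup E] [NormedSpace ℝ E] [FiniteDimensional ℝ E] {X : Set E}

/-- A pointwise one-sided tangent cone condition on a Baire set becomes a uniform two-sided
condition on a nonempty relatively open subset. -/
theorem exists_uniform_cone [LocallyCompactSpace X] {F : Type*} [NormedAddCommGroup F]
    [InnerProductSpace ℝ F] [FiniteDimensional ℝ F] (hne : X.Nonempty) {v : F} (hv : v ≠ 0)
    (h : ∀ q ∈ X, ∃ (S : E →L[ℝ] F) (D : ℝ), (∀ᶠ x in 𝓝[X] q, ‖x - q‖ ≤ D * ‖S (x - q)‖) ∧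
      ∀ ε > 0, ∀ᶠ x in 𝓝[X] q, ⟪v, S (x - q)⟫ ≤ ε * ‖x - q‖) :
    ∃ (T : E →L[ℝ] F) (C : ℝ) (W : Set E), IsOpen W ∧ (X ∩ W).Nonempty ∧
      ∀ x ∈ X ∩ W, ∀ y ∈ X ∩ W,
        ‖x - y‖ ≤ C * ‖T (x - y)‖ ∧ |⟪v, T (x - y)⟫| ≤ ‖v‖ / 2 * ‖T (x - y)‖ := by
  have : ProperSpace (E →L[ℝ] F) := FiniteDimensional.proper ℝ _
  have : Nonempty X := hne.to_subtype
  -- The indices record a radius, an expansion constant and a member of a dense sequence of linear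
  -- maps, so countably many closed sets suffice. The two inequalities together give `⟪v, T w⟫ ≤ ‖v‖
  -- / 2 * ‖T w‖`.
  let G : ℕ × ℕ × ℕ → Set X := fun i => {q | ∀ x ∈ X, dist x (q : E) < 1 / ((i.1 : ℝ) + 1) →
    ‖x - q‖ ≤ ((i.2.1 : ℝ) + 1) * ‖TopologicalSpace.denseSeq (E →L[ℝ] F) i.2.2 (x - q)‖ ∧
    2 * ((i.2.1 : ℝ) + 1) * ⟪v, TopologicalSpace.denseSeq (E →L[ℝ] F) i.2.2 (x - q)⟫ ≤
      ‖v‖ * ‖x - q‖}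
  have hG : ∀ i, IsClosed (G i) := fun i => by
    refine isClosed_forall_dist_lt_imp continuous_subtype_val X _ fun x _ => ?_
    rw [Set.ofPred_and]
    exact (isClosed_le (by fun_prop) (by fun_prop)).inter
      (isClosed_le (by fun_prop) (by fun_prop))
  have hU : ⋃ i, G i = univ := by
    refine eq_univ_of_forall fun q => mem_iUnion.2 ?_
    obtain ⟨S, D, h1, h2⟩ := h q q.2
    obtain ⟨n, hn⟩ := exists_nat_ge (2 * |D|)
    have hn0 : (0 : ℝ) < (n : ℝ) + 1 := by positivity
    obtain ⟨i, hi⟩ := (TopologicalSpace.denseRange_denseSeq (E →L[ℝ] F)).exists_dist_lt S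
      (ε := 1 / (4 * ((n : ℝ) + 1))) (by positivity)
    have hvp : 0 < ‖v‖ := norm_pos_iff.2 hv
    have h3 := h1.and (h2 (‖v‖ / (4 * ((n : ℝ) + 1))) (by positivity))
    obtain ⟨δ, hδ, hδ'⟩ := Metric.mem_nhdsWithin_iff.1 h3
    obtain ⟨j, hj⟩ := exists_nat_one_div_lt hδ
    refine ⟨(j, n, i), fun x hx hxq => ?_⟩
    obtain ⟨e1, e2⟩ := hδ' ⟨Metric.mem_ball.2 (hxq.trans hj), hx⟩
    set T := TopologicalSpace.denseSeq (E →L[ℝ] F) i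
    set w := x - (q : E)
    change ‖w‖ ≤ ((n : ℝ) + 1) * ‖T w‖ ∧ 2 * ((n : ℝ) + 1) * ⟪v, T w⟫ ≤ ‖v‖ * ‖w‖
    have e3 : ‖(S - T) w‖ ≤ 1 / (4 * ((n : ℝ) + 1)) * ‖w‖ := by
      refine ((S - T).le_opNorm w).trans ?_
      gcongr
      rw [← dist_eq_norm]
      exact hi.le
    have hS : S w = (S - T) w + T w := by simp
    have hT : T w = S w - (S - T) w := by simp
    constructor
    · have a1 : ‖S w‖ ≤ 1 / (4 * ((n : ℝ) + 1)) * ‖w‖ + ‖T w‖ := by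
        rw [hS]; exact (norm_add_le _ _).trans (by gcongr)
      have a2 : ‖w‖ ≤ |D| * (1 / (4 * ((n : ℝ) + 1)) * ‖w‖ + ‖T w‖) :=
        e1.trans (mul_le_mul (le_abs_self D) a1 (norm_nonneg _) (abs_nonneg _))
      have a3 : |D| * (1 / (4 * ((n : ℝ) + 1)) * ‖w‖) ≤ 1 / 2 * ‖w‖ := by
        rw [← mul_assoc]
        gcongr
        rw [mul_one_div, div_le_iff₀ (by positivity)]
        linarith
      have a4 : |D| * ‖T w‖ ≤ ((n : ℝ) + 1) / 2 * ‖T w‖ := by gcongr; linarith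
      rw [mul_add] at a2
      linarith
    · have a1 := neg_le_of_abs_le (abs_real_inner_le_norm v ((S - T) w))
      have a2 : ‖v‖ * ‖(S - T) w‖ ≤ ‖v‖ * (1 / (4 * ((n : ℝ) + 1)) * ‖w‖) := by gcongr
      have a3 : ⟪v, T w⟫ ≤ ‖v‖ / (4 * ((n : ℝ) + 1)) * ‖w‖ +
          ‖v‖ * (1 / (4 * ((n : ℝ) + 1)) * ‖w‖) := by
        rw [hT, inner_sub_right]; linarith
      calc 2 * ((n : ℝ) + 1) * ⟪v, T w⟫ ≤ 2 * ((n : ℝ) + 1) *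
            (‖v‖ / (4 * ((n : ℝ) + 1)) * ‖w‖ + ‖v‖ * (1 / (4 * ((n : ℝ) + 1)) * ‖w‖)) := by
              gcongr
        _ = ‖v‖ * ‖w‖ := by field_simp; ring
  obtain ⟨⟨j, n, i⟩, q, hq⟩ := nonempty_interior_of_iUnion_of_closed hG hU
  obtain ⟨O, hO, hOq⟩ := mem_nhds_subtype X q _ |>.1 (mem_interior_iff_mem_nhds.1 hq)
  obtain ⟨δ, hδ, hδO⟩ := Metric.mem_nhds_iff.1 hO
  have hj0 : (0 : ℝ) < 1 / ((j : ℝ) + 1) := by positivity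
  have hn0 : (0 : ℝ) < (n : ℝ) + 1 := by positivity
  refine ⟨TopologicalSpace.denseSeq (E →L[ℝ] F) i, (n : ℝ) + 1,
    Metric.ball q (min δ (1 / ((j : ℝ) + 1) / 2)), Metric.isOpen_ball,
    ⟨q, q.2, Metric.mem_ball_self (by positivity)⟩, ?_⟩
  have key : ∀ x ∈ X ∩ Metric.ball (q : E) (min δ (1 / ((j : ℝ) + 1) / 2)),
      ∀ y ∈ X ∩ Metric.ball (q : E) (min δ (1 / ((j : ℝ) + 1) / 2)),
      ‖x - y‖ ≤ ((n : ℝ) + 1) * ‖TopologicalSpace.denseSeq (E →L[ℝ] F) i (x - y)‖ ∧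
      ⟪v, TopologicalSpace.denseSeq (E →L[ℝ] F) i (x - y)⟫ ≤
        ‖v‖ / 2 * ‖TopologicalSpace.denseSeq (E →L[ℝ] F) i (x - y)‖ := by
    intro x hx y hy
    have hyG : (⟨y, hy.1⟩ : X) ∈ G (j, n, i) :=
      hOq (hδO (Metric.ball_subset_ball (min_le_left _ _) hy.2))
    have hxy : dist x y < 1 / ((j : ℝ) + 1) := by
      have b1 := (Metric.mem_ball.1 hx.2).trans_le (min_le_right _ _)
      have b2 := (Metric.mem_ball.1 hy.2).trans_le (min_le_right _ _)
      have b3 := dist_triangle_right x y q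
      linarith
    obtain ⟨c1, c2⟩ := hyG x hx.1 hxy
    simp only at c1 c2
    refine ⟨c1, ?_⟩
    have c3 := c2.trans (mul_le_mul_of_nonneg_left c1 (norm_nonneg v))
    refine le_of_mul_le_mul_left (a := 2 * ((n : ℝ) + 1)) ?_ (by positivity)
    linarith
  intro x hx y hy
  refine ⟨(key x hx y hy).1, abs_le.2 ⟨?_, (key x hx y hy).2⟩⟩
  -- The estimate is uniform in both points, so exchanging them gives the opposite sign.
  have := (key y hy x hx).2
  rw [← neg_sub x y, map_neg, norm_neg, inner_neg_right] at this
  linarith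

/-- A bounded-below linear map that is nowhere nearly parallel to `v` stays bounded below after
projecting away from `v`. -/
theorem exists_projection_expanding {m : ℕ} {v : EuclideanSpace ℝ (Fin m)} (hv : v ≠ 0) :
    ∃ l, m = l + 1 ∧ ∃ P : EuclideanSpace ℝ (Fin m) →L[ℝ] EuclideanSpace ℝ (Fin l),
      ∀ y, |⟪v, y⟫| ≤ ‖v‖ / 2 * ‖y‖ → ‖y‖ ≤ 2 * ‖P y‖ := by
  cases m with
  | zero => exact absurd (Subsingleton.elim v 0) hv
  | succ l =>
    have : Fact (Module.finrank ℝ (EuclideanSpace ℝ (Fin (l + 1))) = l + 1) := ⟨by simp⟩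
    let b := (OrthonormalBasis.fromOrthogonalSpanSingleton (𝕜 := ℝ) l hv).repr
    refine ⟨l, rfl, (b.toContinuousLinearEquiv : _ →L[ℝ] _) ∘L (ℝ ∙ v)ᗮ.orthogonalProjectionOnto,
      fun y hy => ?_⟩
    have h1 := Submodule.norm_sq_eq_add_norm_sq_projection y (ℝ ∙ v)
    have h2 : ‖(ℝ ∙ v).orthogonalProjectionOnto y‖ ≤ 1 / 2 * ‖y‖ := by
      have hvp : 0 < ‖v‖ := norm_pos_iff.2 hv
      change ‖(ℝ ∙ v).starProjection y‖ ≤ _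
      rw [Submodule.starProjection_singleton, norm_smul, norm_div, Real.norm_eq_abs]
      simp only [RCLike.ofReal_real_eq_id, id_eq, norm_pow, norm_norm]
      rw [div_mul_eq_mul_div, div_le_iff₀ (by positivity)]
      nlinarith
    have h3 : ‖(ℝ ∙ v).orthogonalProjectionOnto y‖ ^ 2 ≤ (1 / 2 * ‖y‖) ^ 2 := by gcongr
    have h4 : ‖b ((ℝ ∙ v)ᗮ.orthogonalProjectionOnto y)‖ = ‖(ℝ ∙ v)ᗮ.orthogonalProjectionOnto y‖ :=
      b.norm_map _
    change ‖y‖ ≤ 2 * ‖b ((ℝ ∙ v)ᗮ.orthogonalProjectionOnto y)‖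
    rw [h4]
    -- The component along `v` has at most half the norm of `y`, so the orthogonal one carries at
    -- least `3 / 4` of its square.
    refine le_of_sq_le_sq ?_ (by positivity)
    nlinarith [sq_nonneg ‖y‖]

/-- A nonempty locally compact `C^1` homogeneous set has a relatively open piece on which some
linear map to a Euclidean space is bi-Lipschitz, with image having nonempty interior. -/
theorem GermHomogeneous.exists_expanding_projection [LocallyCompactSpace X] (hne : X.Nonempty)
    (h : GermHomogeneous 1 X) :
    ∃ (m : ℕ) (T : E →L[ℝ] EuclideanSpace ℝ (Fin m)) (C : ℝ) (W : Set E), IsOpen W ∧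
      (∀ x ∈ X ∩ W, ∀ y ∈ X ∩ W, ‖x - y‖ ≤ C * ‖T (x - y)‖) ∧
      (interior (T '' (X ∩ W))).Nonempty := by
  classical
  -- `Q` holds for the dimension of `E`, so a least `m` exists; empty interior of the image would
  -- produce `Q (m - 1)`.
  let Q : ℕ → Prop := fun m => ∃ (T : E →L[ℝ] EuclideanSpace ℝ (Fin m)) (C : ℝ) (W : Set E),
    IsOpen W ∧ (X ∩ W).Nonempty ∧ ∀ x ∈ X ∩ W, ∀ y ∈ X ∩ W, ‖x - y‖ ≤ C * ‖T (x - y)‖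
  have hQ : ∃ m, Q m := by
    let e : E ≃L[ℝ] EuclideanSpace ℝ (Fin (Module.finrank ℝ E)) :=
      ContinuousLinearEquiv.ofFinrankEq (by simp)
    refine ⟨_, (e : E →L[ℝ] EuclideanSpace ℝ (Fin (Module.finrank ℝ E))), ‖(e.symm : EuclideanSpace ℝ (Fin (Module.finrank ℝ E)) →L[ℝ] E)‖, univ, isOpen_univ, by simpa using hne,
      fun x _ y _ => ?_⟩
    simpa using (e.symm : EuclideanSpace ℝ (Fin (Module.finrank ℝ E)) →L[ℝ] E).le_opNorm (e (x - y))
  obtain ⟨T, C, W, hW, hXW, hT⟩ := Nat.find_spec hQ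
  refine ⟨Nat.find hQ, T, C, W, hW, hT, ?_⟩
  by_contra hint
  rw [not_nonempty_iff_eq_empty] at hint
  obtain ⟨p, hp, v, hv, hpv⟩ := exists_touching_point T hW hXW hT hint
  have hpT : ∀ᶠ x in 𝓝[X] p, ‖x - p‖ ≤ C * ‖T (x - p)‖ := by
    filter_upwards [self_mem_nhdsWithin, mem_nhdsWithin_of_mem_nhds (hW.mem_nhds hp.2)]
      with x h1 h2 using hT x ⟨h1, h2⟩ p hp
  obtain ⟨S, D, W', hW', hXW', hS⟩ := exists_uniform_cone hne hv
    fun q hq => h.transport_cone T hp.1 hq hpT hpv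
  obtain ⟨l, hl, P, hP⟩ := exists_projection_expanding hv
  refine Nat.find_min hQ (m := l) (by omega) ⟨P ∘L S, |D| * 2, W', hW', hXW', fun x hx y hy => ?_⟩
  obtain ⟨h1, h2⟩ := hS x hx y hy
  calc ‖x - y‖ ≤ D * ‖S (x - y)‖ := h1
    _ ≤ |D| * (2 * ‖P (S (x - y))‖) :=
      mul_le_mul (le_abs_self D) (hP _ h2) (norm_nonneg _) (abs_nonneg _)
    _ = |D| * 2 * ‖(P ∘L S) (x - y)‖ := by rw [mul_assoc]; rfl

end Baire

/-! ### Strict differentiability and `C^1` regularity -/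

section Strict

variable {V E : Type*} [NormedAddCommGroup V] [NormedSpace ℝ V] [FiniteDimensional ℝ V]
  [NormedAddCommGroup E] [NormedSpace ℝ E] [FiniteDimensional ℝ E]

/-- A function differentiable on a nonempty open set is strictly differentiable at some point. -/
theorem exists_hasStrictFDerivAt {f : V → E} {B : Set V} (hB : IsOpen B) (hne : B.Nonempty)
    (hf : ∀ y ∈ B, DifferentiableAt ℝ f y) : ∃ y ∈ B, HasStrictFDerivAt f (fderiv ℝ f y) y := by
  have : ProperSpace V := FiniteDimensional.proper ℝ _
  have : ProperSpace (V →L[ℝ] E) := FiniteDimensional.proper ℝ _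
  let D := TopologicalSpace.denseSeq (V →L[ℝ] E)
  -- Points outside `B` belong vacuously, so that for each `n` these closed sets cover all of `V`.
  let G : ℕ → ℕ × ℕ → Set V := fun n i => {y | y ∈ B → ∀ z ∈ B, dist z y < 1 / ((i.1 : ℝ) + 1) →
    ‖f z - f y - D i.2 (z - y)‖ ≤ 1 / ((n : ℝ) + 1) * ‖z - y‖}
  have hG : ∀ n i, IsClosed (G n i) := fun n i => by
    refine isClosed_of_closure_subset fun y hy hyB z hz hzy => ?_
    obtain ⟨u, hu, huy⟩ := mem_closure_iff_seq_limit.1 hy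
    have hfu : Tendsto (fun k => f (u k)) atTop (𝓝 (f y)) :=
      (hf y hyB).continuousAt.tendsto.comp huy
    have h1 : Tendsto (fun k => ‖f z - f (u k) - D i.2 (z - u k)‖) atTop
        (𝓝 ‖f z - f y - D i.2 (z - y)‖) :=
      ((tendsto_const_nhds.sub hfu).sub
        (((D i.2).continuous.tendsto _).comp (tendsto_const_nhds.sub huy))).norm
    have h2 : Tendsto (fun k => 1 / ((n : ℝ) + 1) * ‖z - u k‖) atTop
        (𝓝 (1 / ((n : ℝ) + 1) * ‖z - y‖)) :=
      tendsto_const_nhds.mul (tendsto_const_nhds.sub huy).norm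
    refine le_of_tendsto_of_tendsto h1 h2 ?_
    filter_upwards [huy.eventually (hB.mem_nhds hyB),
      (tendsto_const_nhds.dist huy).eventually_lt_const hzy] with k hk1 hk2
    exact hu k hk1 z hz hk2
  have hU : ∀ n, ⋃ i, G n i = univ := fun n => by
    refine eq_univ_of_forall fun y => mem_iUnion.2 ?_
    by_cases hy : y ∈ B
    swap
    · exact ⟨(0, 0), fun h => absurd h hy⟩
    obtain ⟨i, hi⟩ := (TopologicalSpace.denseRange_denseSeq (V →L[ℝ] E)).exists_dist_lt
      (fderiv ℝ f y) (ε := 1 / 2 * (1 / ((n : ℝ) + 1))) (by positivity)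
    have h1 := isLittleO_iff.1 (hf y hy).hasFDerivAt.isLittleO
      (c := 1 / 2 * (1 / ((n : ℝ) + 1))) (by positivity)
    obtain ⟨δ, hδ, hδ'⟩ := Metric.eventually_nhds_iff.1 h1
    obtain ⟨j, hj⟩ := exists_nat_one_div_lt hδ
    refine ⟨(j, i), fun _ z hz hzy => ?_⟩
    have e1 := hδ' (hzy.trans hj)
    have e2 : ‖(fderiv ℝ f y - D i) (z - y)‖ ≤ 1 / 2 * (1 / ((n : ℝ) + 1)) * ‖z - y‖ := by
      refine (ContinuousLinearMap.le_opNorm _ _).trans ?_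
      gcongr
      rw [← dist_eq_norm]
      exact hi.le
    have e3 : f z - f y - D i (z - y) =
        (f z - f y - fderiv ℝ f y (z - y)) + (fderiv ℝ f y - D i) (z - y) := by
      simp
    change ‖f z - f y - D i (z - y)‖ ≤ _
    rw [e3]
    refine (norm_add_le _ _).trans ?_
    linarith
  have hdense : Dense (⋂ n, ⋃ i, interior (G n i)) :=
    dense_iInter_of_isOpen_nat (fun n => isOpen_iUnion fun i => isOpen_interior)
      fun n => dense_iUnion_interior_of_closed (hG n) (hU n)
  obtain ⟨y, hyB, hy⟩ := hdense.exists_mem_open hB hne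
  refine ⟨y, hy, ?_⟩
  rw [mem_iInter] at hyB
  refine .of_isLittleO (isLittleO_iff.2 fun c hc => ?_)
  obtain ⟨n, hn⟩ := exists_nat_one_div_lt (half_pos hc)
  obtain ⟨⟨j, i⟩, hji⟩ := mem_iUnion.1 (hyB n)
  have hj : (0 : ℝ) < 1 / ((j : ℝ) + 1) / 2 := by positivity
  have hev : ∀ᶠ p : V × V in 𝓝 (y, y),
      ‖f p.1 - f p.2 - D i (p.1 - p.2)‖ ≤ 1 / ((n : ℝ) + 1) * ‖p.1 - p.2‖ := by
    have a1 : ∀ᶠ z in 𝓝 y, z ∈ B ∧ dist z y < 1 / ((j : ℝ) + 1) / 2 :=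
      Filter.Eventually.and (hB.mem_nhds hy) (Metric.ball_mem_nhds _ hj)
    have a2 : ∀ᶠ z in 𝓝 y, z ∈ G n (j, i) := mem_interior_iff_mem_nhds.1 hji
    rw [nhds_prod_eq]
    filter_upwards [a1.prod_mk (a1.and a2)] with p hp
    refine hp.2.2 hp.2.1.1 _ hp.1.1 ?_
    have := dist_triangle_right p.1 p.2 y
    have b1 := hp.1.2
    have b2 := hp.2.1.2
    simp only
    linarith
  -- Fixing the second point at `y` in the uniform estimate shows that the approximating map `D i`
  -- is close to the derivative.
  have hDi : ‖fderiv ℝ f y - D i‖ ≤ 1 / ((n : ℝ) + 1) := by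
    refine ((hf y hy).hasFDerivAt.sub (D i).hasFDerivAt).le_of_lip' (by positivity) ?_
    have hc : Tendsto (fun z : V => (z, y)) (𝓝 y) (𝓝 (y, y)) :=
      Continuous.tendsto' (by fun_prop) _ _ rfl
    filter_upwards [hc.eventually hev] with z hz
    convert hz using 2
    simp only [Pi.sub_apply, map_sub]
    abel
  filter_upwards [hev] with p hp
  have e2 : ‖(D i - fderiv ℝ f y) (p.1 - p.2)‖ ≤ 1 / ((n : ℝ) + 1) * ‖p.1 - p.2‖ := by
    refine (ContinuousLinearMap.le_opNorm _ _).trans ?_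
    gcongr
    rwa [norm_sub_rev]
  have e3 : f p.1 - f p.2 - fderiv ℝ f y (p.1 - p.2) =
      (f p.1 - f p.2 - D i (p.1 - p.2)) + (D i - fderiv ℝ f y) (p.1 - p.2) := by simp
  rw [e3]
  refine (norm_add_le _ _).trans ?_
  have := mul_le_mul_of_nonneg_right hn.le (norm_nonneg (p.1 - p.2))
  linarith

omit [FiniteDimensional ℝ V] [FiniteDimensional ℝ E] in
/-- A function strictly differentiable at every point of an open set is `C^1` there. -/
theorem contDiffOn_one_of_hasStrictFDerivAt {f : V → E} {B : Set V} (hB : IsOpen B)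
    (hf : ∀ y ∈ B, HasStrictFDerivAt f (fderiv ℝ f y) y) : ContDiffOn ℝ 1 f B := by
  rw [← zero_add (1 : WithTop ℕ∞), contDiffOn_succ_iff_fderiv_of_isOpen hB, contDiffOn_zero]
  refine ⟨fun y hy => (hf y hy).hasFDerivAt.differentiableAt.differentiableWithinAt, by simp,
    fun y hy => ContinuousAt.continuousWithinAt ?_⟩
  rw [Metric.continuousAt_iff']
  intro c hc
  have h1 := isLittleO_iff.1 (hf y hy).isLittleO (half_pos hc)
  rw [nhds_prod_eq] at h1
  obtain ⟨s, hs, t, ht, hst⟩ := mem_prod_iff.1 h1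
  filter_upwards [eventually_mem_nhds_iff.2 (inter_mem hs ht), hB.mem_nhds hy] with z hz hzB
  rw [dist_eq_norm]
  refine lt_of_le_of_lt ?_ (half_lt_self hc)
  refine ((hf z hzB).hasFDerivAt.sub (fderiv ℝ f y).hasFDerivAt).le_of_lip' (by positivity) ?_
  filter_upwards [hz] with w hw
  have := hst (mk_mem_prod hw.1 (mem_of_mem_nhds hz).2)
  simp only [mem_ofPred_eq] at this
  rwa [Pi.sub_apply, Pi.sub_apply, sub_sub_sub_comm, ← map_sub]

end Strict

/-! ### Regularity of a parametrization spreads by homogeneity -/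

section Param

variable {E : Type*} [NormedAddCommGroup E] [NormedSpace ℝ E]
  {V : Type*} [NormedAddCommGroup V] [NormedSpace ℝ V]

/-- `σ` parametrizes the relatively open piece `X ∩ W` of `X` by the open set `B`, with inverse the
linear map `T`. -/
structure IsGraphOver (X : Set E) (T : E →L[ℝ] V) (B : Set V) (W : Set E) (σ : V → E) : Prop where
  isOpen_base : IsOpen B
  nonempty_base : B.Nonempty
  isOpen_nhd : IsOpen W
  continuousOn : ContinuousOn σ B
  proj : ∀ y ∈ B, T (σ y) = y
  mem : ∀ y ∈ B, σ y ∈ X ∩ W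
  param : ∀ x ∈ X ∩ W, T x ∈ B ∧ σ (T x) = x

variable {X : Set E} {T : E →L[ℝ] V} {B : Set V} {W : Set E} {σ : V → E}

theorem IsGraphOver.continuousAt (h : IsGraphOver X T B W σ) {y : V} (hy : y ∈ B) :
    ContinuousAt σ y := h.continuousOn.continuousAt (h.isOpen_base.mem_nhds hy)

/-- Near `y` the point `Φ (σ w)` stays in `X` and, by continuity, in `W`, so it is again on the
graph. Thus `T ∘ Φ ∘ σ` is a transition map between parameters. -/
theorem IsGraphOver.eventually_map (h : IsGraphOver X T B W σ) {y z : V} (hy : y ∈ B) (hz : z ∈ B)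
    {Φ Ψ : E → E} (hΦ : ContinuousAt Φ (σ y)) (hyz : Φ (σ y) = σ z)
    (hX : ∀ᶠ x in 𝓝[X] (σ y), Φ x ∈ X ∧ Ψ (Φ x) = x) :
    ∀ᶠ w in 𝓝 y, w ∈ B ∧ T (Φ (σ w)) ∈ B ∧ σ (T (Φ (σ w))) = Φ (σ w) ∧
      Ψ (Φ (σ w)) = σ w := by
  have hB := h.isOpen_base.mem_nhds hy
  have hσ : Tendsto σ (𝓝 y) (𝓝[X] (σ y)) :=
    tendsto_nhdsWithin_iff.2 ⟨h.continuousAt hy, by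
      filter_upwards [hB] with w hw using (h.mem w hw).1⟩
  have hW : ∀ᶠ w in 𝓝 y, Φ (σ w) ∈ W :=
    (ContinuousAt.comp hΦ (h.continuousAt hy)).eventually
      (by simp only [Function.comp]; rw [hyz]; exact h.isOpen_nhd.mem_nhds (h.mem z hz).2)
  filter_upwards [hB, hW, hσ.eventually hX] with w h1 h2 h3
  exact ⟨h1, (h.param _ ⟨h3.1, h2⟩).1, (h.param _ ⟨h3.1, h2⟩).2, h3.2⟩

/-- Homogeneity of a graph in terms of its parametrization. -/
theorem IsGraphOver.exists_transition (h : IsGraphOver X T B W σ) {k : ℕ}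
    (hX : GermHomogeneous k X) {y z : V} (hy : y ∈ B) (hz : z ∈ B) :
    ∃ Φ Ψ : E → E, ContDiffAt ℝ k Φ (σ y) ∧ ContDiffAt ℝ k Ψ (σ z) ∧ Φ (σ y) = σ z ∧
      Ψ (σ z) = σ y ∧
      (∀ᶠ w in 𝓝 y, w ∈ B ∧ T (Φ (σ w)) ∈ B ∧ σ (T (Φ (σ w))) = Φ (σ w) ∧ Ψ (Φ (σ w)) = σ w) ∧
      (∀ᶠ w in 𝓝 z, w ∈ B ∧ T (Ψ (σ w)) ∈ B ∧ σ (T (Ψ (σ w))) = Ψ (σ w) ∧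
        Φ (Ψ (σ w)) = σ w) := by
  obtain ⟨Φ, Ψ, h1, h2, h3, h4, h5, h6⟩ := hX _ (h.mem y hy).1 _ (h.mem z hz).1
  exact ⟨Φ, Ψ, h1, h2, h3, h4, h.eventually_map hy hz h1.continuousAt h3 h5,
    h.eventually_map hz hy h2.continuousAt h4 h6⟩

/-- Apply the estimate at `y + c⁻¹ • v`, multiply by `c` and let `c → ∞`. -/
theorem HasFDerivAt.norm_apply_le {F G : Type*} [NormedAddCommGroup F] [NormedSpace ℝ F]
    [NormedAddCommGroup G] [NormedSpace ℝ G] {f : V → F} {g : V → G} {f' : V →L[ℝ] F}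
    {g' : V →L[ℝ] G} {y : V} {C : ℝ} (hf : HasFDerivAt f f' y) (hg : HasFDerivAt g g' y)
    (h : ∀ᶠ z in 𝓝 y, ‖f z - f y‖ ≤ C * ‖g z - g y‖) (v : V) : ‖f' v‖ ≤ C * ‖g' v‖ := by
  have h1 := (hf.lim_real v).norm
  have h2 := ((hg.lim_real v).norm).const_mul C
  refine le_of_tendsto_of_tendsto h1 h2 ?_
  have h3 : Tendsto (fun c : ℝ => y + c⁻¹ • v) atTop (𝓝 y) := by
    have := (tendsto_inv_atTop_zero (𝕜 := ℝ)).smul_const v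
    simpa using this.const_add y
  filter_upwards [h3.eventually h] with c hc
  rw [norm_smul, norm_smul]
  have := mul_le_mul_of_nonneg_left hc (norm_nonneg c)
  linarith

theorem IsGraphOver.continuousAt_transition (h : IsGraphOver X T B W σ) {z : V} (hz : z ∈ B)
    {Ψ : E → E} (hΨ : ContinuousAt Ψ (σ z)) : ContinuousAt (fun w => T (Ψ (σ w))) z :=
  T.continuous.continuousAt.comp (ContinuousAt.comp hΨ (h.continuousAt hz))

variable [FiniteDimensional ℝ V]

/-- Derivative data for transporting differentiability of a Lipschitz parametrization. -/
theorem IsGraphOver.exists_equiv (h : IsGraphOver X T B W σ) {C : ℝ}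
    (hC : ∀ y ∈ B, ∀ z ∈ B, ‖σ y - σ z‖ ≤ C * ‖y - z‖) {y : V} (hy : y ∈ B)
    {Φ Ψ : E → E} {A A' : E →L[ℝ] E} (hΦ : HasFDerivAt Φ A (σ y))
    (hΨ : HasFDerivAt Ψ A' (Φ (σ y))) {D : V →L[ℝ] E} (hD : HasFDerivAt σ D y)
    (hev : ∀ᶠ w in 𝓝 y, w ∈ B ∧ T (Φ (σ w)) ∈ B ∧ σ (T (Φ (σ w))) = Φ (σ w) ∧
      Ψ (Φ (σ w)) = σ w) :
    ∃ e : V ≃L[ℝ] V, (e : V →L[ℝ] V) = T ∘L A ∘L D := by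
  have hf : HasFDerivAt (fun w => Φ (σ w)) (A ∘L D) y := hΦ.comp y hD
  have hg : HasFDerivAt (fun w => T (Φ (σ w))) (T ∘L A ∘L D) y := T.hasFDerivAt.comp y hf
  have hTD : T ∘L D = .id ℝ V := by
    refine (T.hasFDerivAt.comp y hD).unique ((hasFDerivAt_id y).congr_of_eventuallyEq ?_)
    filter_upwards [h.isOpen_base.mem_nhds hy] with w hw using h.proj w hw
  have hAD : A' ∘L A ∘L D = D := by
    refine (hΨ.comp y hf).unique (hD.congr_of_eventuallyEq ?_)
    filter_upwards [hev] with w hw using hw.2.2.2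
  have hle := hf.norm_apply_le (C := C) hg (by
    filter_upwards [hev] with w hw
    have h1 := hC _ hw.2.1 _ hev.self_of_nhds.2.1
    rwa [hw.2.2.1, hev.self_of_nhds.2.2.1] at h1)
  -- If `T A D v = 0`, the Lipschitz bound gives `A D v = 0`, then `A' A D = D` gives `D v = 0`, and
  -- `T D = id` gives `v = 0`.
  have hinj : Function.Injective (T ∘L A ∘L D) := by
    refine (injective_iff_map_eq_zero _).2 fun v hv => ?_
    have h1 := hle v
    rw [hv, norm_zero, mul_zero] at h1
    have h2 : A (D v) = 0 := norm_le_zero_iff.1 h1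
    have h3 : D v = 0 := by
      have := DFunLike.congr_fun hAD v
      simp only [ContinuousLinearMap.comp_apply, h2, map_zero] at this
      exact this.symm
    have h4 := DFunLike.congr_fun hTD v
    simp only [ContinuousLinearMap.comp_apply, h3, map_zero] at h4
    exact h4.symm
  exact ⟨(LinearEquiv.ofInjectiveEndo (T ∘L A ∘L D : V →L[ℝ] V).toLinearMap
    hinj).toContinuousLinearEquiv, by ext v; rfl⟩

/-- Near `z`, `σ` equals `(Φ ∘ σ) ∘ (T ∘ Ψ ∘ σ)`. The inner map is a continuous local inverse of `T
∘ Φ ∘ σ`, whose derivative at `y` is invertible, so it is differentiable without assuming that `σ`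
is differentiable at `z`. -/
theorem IsGraphOver.differentiableAt (h : IsGraphOver X T B W σ) {C : ℝ}
    (hC : ∀ y ∈ B, ∀ z ∈ B, ‖σ y - σ z‖ ≤ C * ‖y - z‖) (hX : GermHomogeneous 1 X) {y z : V}
    (hy : y ∈ B) (hz : z ∈ B) (hd : DifferentiableAt ℝ σ y) : DifferentiableAt ℝ σ z := by
  obtain ⟨Φ, Ψ, h1, h2, h3, h4, h5, h6⟩ := h.exists_transition hX hy hz
  have hΦ := (h1.differentiableAt (by norm_num)).hasFDerivAt
  have hΨ := (h2.differentiableAt (by norm_num)).hasFDerivAt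
  obtain ⟨e, he⟩ := h.exists_equiv hC hy hΦ (h3.symm ▸ hΨ) hd.hasFDerivAt h5
  have hTz : T (Ψ (σ z)) = y := by rw [h4, h.proj y hy]
  have hcomp : ∀ᶠ w in 𝓝 z, Φ (σ (T (Ψ (σ w)))) = σ w := by
    filter_upwards [h6] with w hw
    rw [hw.2.2.1, hw.2.2.2]
  have hg : HasFDerivAt (fun w => T (Φ (σ w))) (e : V →L[ℝ] V) (T (Ψ (σ z))) := by
    rw [he, hTz]
    exact T.hasFDerivAt.comp y (hΦ.comp y hd.hasFDerivAt)
  have hg' := hg.of_local_left_inverse (g := fun w => T (Ψ (σ w)))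
    (h.continuousAt_transition hz h2.continuousAt) (by
      filter_upwards [h6, hcomp] with w hw hw'
      rw [hw', h.proj w hw.1])
  have hf : HasFDerivAt (fun w => Φ (σ w)) (fderiv ℝ Φ (σ y) ∘L fderiv ℝ σ y) (T (Ψ (σ z))) := by
    rw [hTz]; exact hΦ.comp y hd.hasFDerivAt
  exact ((hf.comp z hg').congr_of_eventuallyEq
    (hcomp.mono fun w hw => hw.symm)).differentiableAt

/-- The factorization of `σ` through `T ∘ Ψ ∘ σ` used for plain differentiability also transports
strict derivatives. -/
theorem IsGraphOver.hasStrictFDerivAt (h : IsGraphOver X T B W σ) {C : ℝ}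
    (hC : ∀ y ∈ B, ∀ z ∈ B, ‖σ y - σ z‖ ≤ C * ‖y - z‖) (hX : GermHomogeneous 1 X) {y z : V}
    (hy : y ∈ B) (hz : z ∈ B) {D : V →L[ℝ] E} (hd : HasStrictFDerivAt σ D y) :
    HasStrictFDerivAt σ (fderiv ℝ σ z) z := by
  obtain ⟨Φ, Ψ, h1, h2, h3, h4, h5, h6⟩ := h.exists_transition hX hy hz
  have hΦ := h1.hasStrictFDerivAt (by norm_num)
  have hΨ := (h2.differentiableAt (by norm_num)).hasFDerivAt
  obtain ⟨e, he⟩ := h.exists_equiv hC hy hΦ.hasFDerivAt (h3.symm ▸ hΨ) hd.hasFDerivAt h5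
  have hTz : T (Ψ (σ z)) = y := by rw [h4, h.proj y hy]
  have hcomp : ∀ᶠ w in 𝓝 z, Φ (σ (T (Ψ (σ w)))) = σ w := by
    filter_upwards [h6] with w hw
    rw [hw.2.2.1, hw.2.2.2]
  have hg : HasStrictFDerivAt (fun w => T (Φ (σ w))) (e : V →L[ℝ] V) (T (Ψ (σ z))) := by
    rw [he, hTz]
    exact T.hasStrictFDerivAt.comp y (hΦ.comp y hd)
  have hg' := hg.of_local_left_inverse (g := fun w => T (Ψ (σ w)))
    (h.continuousAt_transition hz h2.continuousAt) (by
      filter_upwards [h6, hcomp] with w hw hw'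
      rw [hw', h.proj w hw.1])
  have hf : HasStrictFDerivAt (fun w => Φ (σ w)) (fderiv ℝ Φ (σ y) ∘L D) (T (Ψ (σ z))) := by
    rw [hTz]; exact hΦ.comp y hd
  have hs : HasStrictFDerivAt (fun w => Φ (σ (T (Ψ (σ w)))))
      ((fderiv ℝ Φ (σ y) ∘L D) ∘L (e.symm : V →L[ℝ] V)) z := hf.comp z hg'
  replace hs := hs.congr_of_eventuallyEq (f₁ := σ) hcomp
  exact hs.hasFDerivAt.fderiv ▸ hs

end Param

/-! ### The `C^1` case -/

/-- A nonempty locally compact `C^1` homogeneous set is somewhere a `C^1` graph. -/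
theorem GermHomogeneous.exists_graph_one {E : Type*} [NormedAddCommGroup E] [NormedSpace ℝ E]
    [FiniteDimensional ℝ E] {X : Set E} [LocallyCompactSpace X] (hne : X.Nonempty)
    (hX : GermHomogeneous 1 X) :
    ∃ (m : ℕ) (T : E →L[ℝ] EuclideanSpace ℝ (Fin m)) (B : Set (EuclideanSpace ℝ (Fin m)))
      (W : Set E) (σ : EuclideanSpace ℝ (Fin m) → E),
      IsGraphOver X T B W σ ∧ ContDiffOn ℝ 1 σ B := by
  obtain ⟨m, T, C, W, hW, hT, hint⟩ := hX.exists_expanding_projection hne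
  let B := interior (T '' (X ∩ W))
  have hex : ∀ y, ∃ x, y ∈ B → x ∈ X ∩ W ∧ T x = y := fun y => by
    by_cases hy : y ∈ B
    · obtain ⟨x, hx, hxy⟩ := interior_subset hy
      exact ⟨x, fun _ => ⟨hx, hxy⟩⟩
    · exact ⟨0, fun h => absurd h hy⟩
  choose σ hσ using hex
  have hC : ∀ y ∈ B, ∀ z ∈ B, ‖σ y - σ z‖ ≤ |C| * ‖y - z‖ := fun y hy z hz => by
    have := hT _ (hσ y hy).1 _ (hσ z hz).1
    rw [map_sub, (hσ y hy).2, (hσ z hz).2] at this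
    exact this.trans (by gcongr; exact le_abs_self C)
  have hLip : LipschitzOnWith ⟨|C|, abs_nonneg C⟩ σ B :=
    LipschitzOnWith.of_dist_le_mul fun y hy z hz => by
      rw [dist_eq_norm, dist_eq_norm]; exact hC y hy z hz
  have hgr : IsGraphOver X T B (W ∩ T ⁻¹' B) σ := by
    refine ⟨isOpen_interior, hint, hW.inter (isOpen_interior.preimage T.continuous),
      hLip.continuousOn, fun y hy => (hσ y hy).2, fun y hy => ⟨(hσ y hy).1.1, (hσ y hy).1.2, ?_⟩,
      fun x hx => ⟨hx.2.2, ?_⟩⟩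
    · rw [mem_preimage, (hσ y hy).2]; exact hy
    · have h1 := hσ (T x) hx.2.2
      have h2 := hT _ h1.1 _ ⟨hx.1, hx.2.1⟩
      rw [map_sub, h1.2, sub_self, norm_zero, mul_zero] at h2
      exact sub_eq_zero.1 (norm_le_zero_iff.1 h2)
  refine ⟨m, T, B, _, σ, hgr, ?_⟩
  -- Rademacher: `σ` is differentiable almost everywhere on `B`, which has positive measure.
  obtain ⟨y, hy, hyd⟩ : ∃ y ∈ B, DifferentiableAt ℝ σ y := by
    have hae := hLip.ae_differentiableWithinAt_of_mem (μ := MeasureTheory.volume)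
    have hpos : 0 < MeasureTheory.volume B := isOpen_interior.measure_pos _ hint
    by_contra! hcon
    refine hpos.ne' (MeasureTheory.measure_mono_null (fun y hy => ?_) hae)
    exact fun h => hcon y hy ((h hy).differentiableAt (isOpen_interior.mem_nhds hy))
  obtain ⟨z, hz, hzs⟩ := exists_hasStrictFDerivAt isOpen_interior hint
    fun z hz => hgr.differentiableAt hC hX hy hz hyd
  exact contDiffOn_one_of_hasStrictFDerivAt isOpen_interior
    fun w hw => hgr.hasStrictFDerivAt hC hX hz hw hzs

/-! ### Injective `C^1` maps -/

section InjectiveMaps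

variable {U V : Type*} [NormedAddCommGroup U] [NormedSpace ℝ U] [FiniteDimensional ℝ U]
  [NormedAddCommGroup V] [NormedSpace ℝ V] [FiniteDimensional ℝ V]

omit [FiniteDimensional ℝ U] in
theorem eq_zero_of_ball_subset_fiber {u₀ : U} {r : ℝ} (hr : 0 < r) {v : U}
    (h : ∀ t : ℝ, u₀ + t • v ∈ Metric.ball u₀ r → t • v = 0) : v = 0 := by
  by_contra hv
  have hvp : 0 < ‖v‖ := norm_pos_iff.2 hv
  have h1 := h (r / (2 * ‖v‖)) (by
    rw [Metric.mem_ball, dist_eq_norm, add_sub_cancel_left, norm_smul, Real.norm_eq_abs,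
      abs_of_pos (by positivity)]
    rw [show r / (2 * ‖v‖) * ‖v‖ = r / 2 by field_simp]
    linarith)
  rcases smul_eq_zero.1 h1 with h2 | h2
  · have : 0 < r / (2 * ‖v‖) := by positivity
    exact this.ne' h2
  · exact hv h2

/-- An injective `C^1` map on a nonempty open set is an immersion at some point. -/
theorem exists_injective_fderiv {h : U → V} {B : Set U} (hB : IsOpen B) (hne : B.Nonempty)
    (hh : ContDiffOn ℝ 1 h B) (hinj : InjOn h B) :
    ∃ z ∈ B, Function.Injective (fderiv ℝ h z) := by
  let rk : U → ℕ := fun z => Module.finrank ℝ (LinearMap.range (fderiv ℝ h z).toLinearMap)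
  -- At a point of maximal rank the rank is locally constant; a nonzero kernel would yield a
  -- positive-dimensional fibre of `h`.
  obtain ⟨z₀, hz₀, hmax⟩ : ∃ z₀ ∈ B, ∀ z ∈ B, rk z ≤ rk z₀ := by
    have hbdd : BddAbove (rk '' B) := ⟨Module.finrank ℝ V, by
      rintro _ ⟨z, _, rfl⟩
      exact Submodule.finrank_le _⟩
    obtain ⟨z₀, hz₀, h0⟩ := Nat.sSup_mem (hne.image rk) hbdd
    exact ⟨z₀, hz₀, fun z hz => h0 ▸ le_csSup hbdd (mem_image_of_mem _ hz)⟩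
  refine ⟨z₀, hz₀, ?_⟩
  have hdiff : ∀ z ∈ B, HasFDerivAt h (fderiv ℝ h z) z := fun z hz =>
    ((hh.contDiffAt (hB.mem_nhds hz)).differentiableAt (by norm_num)).hasFDerivAt
  set A := fderiv ℝ h z₀ with hA
  let R := LinearMap.range A.toLinearMap
  let K := LinearMap.ker A.toLinearMap
  obtain ⟨Q₀, hQ₀⟩ := R.subtype.exists_leftInverse_of_injective (Submodule.ker_subtype R)
  obtain ⟨P₀, hP₀⟩ := K.subtype.exists_leftInverse_of_injective (Submodule.ker_subtype K)
  let Q : V →L[ℝ] R := Q₀.toContinuousLinearMap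
  let P : U →L[ℝ] K := P₀.toContinuousLinearMap
  have hQ : ∀ r : R, Q r = r := fun r => DFunLike.congr_fun hQ₀ r
  have hP : ∀ r : K, P r = r := fun r => DFunLike.congr_fun hP₀ r
  -- Local coordinates at `z₀`: `Q ∘ h` records the image directions and `P` those of the kernel.
  -- The curve family `c` fixes the first coordinate.
  let G : U → R × K := fun z => (Q (h z), P z)
  let L : U →ₗ[ℝ] R × K := ((Q ∘L A).prod P).toLinearMap
  have hL : Function.Injective L := by
    refine (injective_iff_map_eq_zero L).2 fun u hu => ?_
    obtain ⟨h1, h2⟩ := Prod.ext_iff.1 hu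
    have h3 : Q (A u) = 0 := h1
    rw [hQ ⟨A u, u, rfl⟩] at h3
    have h4 : A u = 0 := congrArg Subtype.val h3
    have h5 : P u = 0 := h2
    rw [hP ⟨u, h4⟩] at h5
    exact congrArg Subtype.val h5
  have hdim : Module.finrank ℝ U = Module.finrank ℝ (R × K) := by
    rw [Module.finrank_prod, LinearMap.finrank_range_add_finrank_ker]
  let e : U ≃L[ℝ] R × K := (LinearMap.linearEquivOfInjective L hL hdim).toContinuousLinearEquiv
  have hG : ContDiffAt ℝ 1 G z₀ :=
    (Q.contDiff.contDiffAt.comp z₀ (hh.contDiffAt (hB.mem_nhds hz₀))).prodMk P.contDiff.contDiffAt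
  have hG' : HasFDerivAt G (e : U →L[ℝ] R × K) z₀ := by
    have he : (e : U →L[ℝ] R × K) = (Q ∘L A).prod P := by ext u <;> rfl
    rw [he]
    exact (Q.hasFDerivAt.comp z₀ (hdiff z₀ hz₀)).prodMk P.hasFDerivAt
  have hstrict := hG.hasStrictFDerivAt' hG' (by norm_num)
  let Γ := hG.localInverse hG' (by norm_num)
  have hΓ : ContDiffAt ℝ 1 Γ (G z₀) := hG.to_localInverse hG' (by norm_num)
  have hΓ₀ : Γ (G z₀) = z₀ := hG.localInverse_apply_image hG' (by norm_num)
  have hΓr : ∀ᶠ y in 𝓝 (G z₀), G (Γ y) = y := hstrict.eventually_right_inverse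
  let c : K → U := fun k => Γ (Q (h z₀), k)
  have hpair : ContDiff ℝ 1 (fun k : K => ((Q (h z₀), k) : R × K)) :=
    contDiff_const.prodMk contDiff_id
  have hc : ContDiffAt ℝ 1 c (P z₀) := ContDiffAt.comp (P z₀) hΓ hpair.contDiffAt
  have hc₀ : c (P z₀) = z₀ := hΓ₀
  have hGc : ∀ᶠ k in 𝓝 (P z₀), G (c k) = (Q (h z₀), k) :=
    (hpair.continuous.tendsto (P z₀)).eventually hΓr
  have hsurj : ∀ᶠ z in 𝓝 z₀, Function.Surjective (Q ∘L fderiv ℝ h z) := by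
    have hs : LinearMap.range (Q ∘L A).toLinearMap = ⊤ := by
      rw [LinearMap.range_eq_top]
      rintro ⟨_, u, rfl⟩
      exact ⟨u, hQ ⟨A u, u, rfl⟩⟩
    obtain ⟨j₀, hj₀⟩ := (Q ∘L A).toLinearMap.exists_rightInverse_of_surjective hs
    let j : R →L[ℝ] U := j₀.toContinuousLinearMap
    have hcont : ContinuousAt (fun z => (Q ∘L fderiv ℝ h z) ∘L j) z₀ := by
      have h1 : ContinuousAt (fderiv ℝ h) z₀ :=
        ((hh.contDiffAt (hB.mem_nhds hz₀)).fderiv_right (m := 0) (by norm_num)).continuousAt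
      exact ((continuous_const.clm_comp continuous_id).continuousAt.comp h1).clm_comp
        continuousAt_const
    have hid : (Q ∘L fderiv ℝ h z₀) ∘L j = ((ContinuousLinearEquiv.refl ℝ R : R ≃L[ℝ] R) :
        R →L[ℝ] R) := by
      ext1 r
      exact DFunLike.congr_fun hj₀ r
    have hnh := (ContinuousLinearEquiv.refl ℝ R).nhds
    rw [← hid] at hnh
    filter_upwards [hcont.eventually hnh] with z ⟨e', he'⟩ r
    refine ⟨j (e'.symm r), ?_⟩
    have := DFunLike.congr_fun he' (e'.symm r)
    simpa using this.symm
  have hev : ∀ᶠ k in 𝓝 (P z₀), DifferentiableAt ℝ c k ∧ c k ∈ B ∧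
      (∀ᶠ k' in 𝓝 k, G (c k') = (Q (h z₀), k')) ∧
      Function.Surjective (Q ∘L fderiv ℝ h (c k)) := by
    have ht : Tendsto c (𝓝 (P z₀)) (𝓝 z₀) := by
      have := hc.continuousAt.tendsto
      rwa [hc₀] at this
    filter_upwards [hc.eventually (by simp), ht.eventually (hB.mem_nhds hz₀),
      eventually_eventually_nhds.2 hGc, ht.eventually hsurj] with k h1 h2 h3 h4
    exact ⟨h1.differentiableAt (by norm_num), h2, h3, h4⟩
  obtain ⟨r, hr, hball⟩ := Metric.eventually_nhds_iff_ball.1 hev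
  have hder : ∀ k ∈ Metric.ball (P z₀) r, HasFDerivAt (fun k => h (c k)) (0 : K →L[ℝ] V) k := by
    intro k hk
    obtain ⟨h1, h2, h3, h4⟩ := hball k hk
    have h5 : HasFDerivAt (fun k => h (c k)) (fderiv ℝ h (c k) ∘L fderiv ℝ c k) k :=
      (hdiff _ h2).comp k h1.hasFDerivAt
    -- By maximality of the rank, `Q` is injective on the range of the derivative at `c k`, so
    -- killing the `Q`-part kills the whole derivative of `h ∘ c`.
    have h6 : Q ∘L (fderiv ℝ h (c k) ∘L fderiv ℝ c k) = 0 := by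
      refine (Q.hasFDerivAt.comp k h5).unique
        ((hasFDerivAt_const (Q (h z₀)) k).congr_of_eventuallyEq ?_)
      filter_upwards [h3] with k' hk' using (Prod.ext_iff.1 hk').1
    convert h5
    symm
    let N := Q.toLinearMap ∘ₗ (LinearMap.range (fderiv ℝ h (c k)).toLinearMap).subtype
    have hNs : Function.Surjective N := fun r => by
      obtain ⟨u, hu⟩ := h4 r
      exact ⟨⟨_, u, rfl⟩, hu⟩
    have hNd : Module.finrank ℝ (LinearMap.range (fderiv ℝ h (c k)).toLinearMap) =
        Module.finrank ℝ R :=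
      le_antisymm (hmax _ h2) (LinearMap.finrank_le_finrank_of_surjective hNs)
    have hNi : Function.Injective N :=
      (LinearMap.injective_iff_surjective_of_finrank_eq_finrank hNd).2 hNs
    ext1 v
    have h7 : N ⟨fderiv ℝ h (c k) (fderiv ℝ c k v), _, rfl⟩ = 0 := DFunLike.congr_fun h6 v
    exact congrArg Subtype.val ((injective_iff_map_eq_zero N).1 hNi _ h7)
  have hconst : ∀ k ∈ Metric.ball (P z₀) r, h (c k) = h (c (P z₀)) := fun k hk => by
    refine (convex_ball (P z₀) r).is_const_of_fderivWithin_eq_zero (𝕜 := ℝ) (f := fun k => h (c k))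
      (fun k hk => (hder k hk).differentiableAt.differentiableWithinAt) (fun k hk => ?_) hk
      (Metric.mem_ball_self hr)
    rw [fderivWithin_of_isOpen Metric.isOpen_ball hk]
    exact (hder k hk).fderiv
  refine (injective_iff_map_eq_zero A).2 fun u hu => ?_
  have hu0 : (⟨u, hu⟩ : K) = 0 := by
    refine eq_zero_of_ball_subset_fiber (u₀ := P z₀) hr fun t ht => ?_
    have h1 := hinj (hball _ ht).2.1 (hball _ (Metric.mem_ball_self hr)).2.1 (hconst _ ht)
    have h2 := (Prod.ext_iff.1 (hball _ ht).2.2.1.self_of_nhds).2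
    have h3 := (Prod.ext_iff.1 (hball _ (Metric.mem_ball_self hr)).2.2.1.self_of_nhds).2
    rw [h1] at h2
    simpa using h2.symm.trans h3
  exact congrArg Subtype.val hu0

/-- An injective `C^1` map that is open onto its image in the target has bijective derivative
at some point. -/
theorem exists_equiv_fderiv {h : U → V} {B : Set U} (hB : IsOpen B) (hne : B.Nonempty)
    (hh : ContDiffOn ℝ 1 h B) (hinj : InjOn h B) (hopen : ∀ O ⊆ B, IsOpen O → IsOpen (h '' O)) :
    ∃ z ∈ B, ∃ e : U ≃L[ℝ] V, HasFDerivAt h (e : U →L[ℝ] V) z := by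
  obtain ⟨z, hz, hA⟩ := exists_injective_fderiv hB hne hh hinj
  have hstrict := (hh.contDiffAt (hB.mem_nhds hz)).hasStrictFDerivAt (by norm_num)
  set A := fderiv ℝ h z
  obtain ⟨Q₀, hQ₀⟩ := A.toLinearMap.exists_leftInverse_of_injective (LinearMap.ker_eq_bot.2 hA)
  let Q : V →L[ℝ] U := Q₀.toContinuousLinearMap
  have hQA : ∀ u, Q (A u) = u := fun u => DFunLike.congr_fun hQ₀ u
  have hQh : HasStrictFDerivAt (fun z => Q (h z))
      ((ContinuousLinearEquiv.refl ℝ U : U ≃L[ℝ] U) : U →L[ℝ] U) z := by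
    have : ((ContinuousLinearEquiv.refl ℝ U : U ≃L[ℝ] U) : U →L[ℝ] U) = Q ∘L A := by
      ext u; exact (hQA u).symm
    rw [this]
    exact Q.hasStrictFDerivAt.comp z hstrict
  let f := hQh.toOpenPartialHomeomorph
  have hfz : z ∈ f.source := hQh.mem_toOpenPartialHomeomorph_source
  have hO := hopen (B ∩ f.source) inter_subset_left (hB.inter f.open_source)
  obtain ⟨r, hr, hball⟩ := Metric.isOpen_iff.1 hO _ (mem_image_of_mem h ⟨hz, hfz⟩)
  -- The image of a neighbourhood on which `Q ∘ h` is injective contains a ball about `h z`; no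
  -- segment of that ball can lie in a fibre of `Q`.
  have hQi : ∀ v, Q v = 0 → v = 0 := fun v hv => by
    refine eq_zero_of_ball_subset_fiber (u₀ := h z) hr fun t ht => ?_
    obtain ⟨w, hw, hwt⟩ := hball ht
    have h1 : Q (h w) = Q (h z) := by rw [hwt]; simp [hv]
    have h2 : w = z := f.injOn hw.2 hfz h1
    rw [h2] at hwt
    simpa using hwt.symm
  refine ⟨z, hz, ContinuousLinearEquiv.equivOfInverse A Q hQA fun v => ?_, hstrict.hasFDerivAt⟩
  refine sub_eq_zero.1 (hQi _ ?_)
  rw [map_sub, hQA, sub_self]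

end InjectiveMaps

/-! ### First order prolongation and gain of a derivative -/

section Prolongation

variable {E : Type*} [NormedAddCommGroup E] [NormedSpace ℝ E]
  {V : Type*} [NormedAddCommGroup V] [NormedSpace ℝ V]
  {X : Set E} {T : E →L[ℝ] V} {B : Set V} {W : Set E} {σ : V → E}

/-- The first order prolongation of a parametrization. -/
noncomputable def prolong (σ : V → E) (y : V) : E × (V →L[ℝ] E) := (σ y, fderiv ℝ σ y)

/-- The action of an ambient map on tangent data of graphs over `T`. -/
noncomputable def prolongMap (T : E →L[ℝ] V) (Φ : E → E) (p : E × (V →L[ℝ] E)) :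
    E × (V →L[ℝ] E) :=
  (Φ p.1, (fderiv ℝ Φ p.1 ∘L p.2) ∘L (T ∘L (fderiv ℝ Φ p.1 ∘L p.2)).inverse)

/-- One derivative is lost because `fderiv ℝ Φ` enters. The hypothesis on `e` keeps
`ContinuousLinearMap.inverse` away from its default value, at a point where inversion is smooth. -/
theorem contDiffAt_prolongMap [CompleteSpace V] {k : ℕ} {Φ : E → E} {p : E × (V →L[ℝ] E)}
    (hΦ : ContDiffAt ℝ (k + 1 : ℕ) Φ p.1) {e : V ≃L[ℝ] V}
    (he : (e : V →L[ℝ] V) = T ∘L (fderiv ℝ Φ p.1 ∘L p.2)) :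
    ContDiffAt ℝ k (prolongMap T Φ) p := by
  have h1 : ContDiffAt ℝ k (fun p : E × (V →L[ℝ] E) => Φ p.1) p :=
    (hΦ.of_le (by exact_mod_cast Nat.le_succ k)).comp p contDiffAt_fst
  have h2 : ContDiffAt ℝ k (fun p : E × (V →L[ℝ] E) => fderiv ℝ Φ p.1 ∘L p.2) p :=
    ((hΦ.fderiv_right (m := k) (by norm_cast)).comp p contDiffAt_fst).clm_comp contDiffAt_snd
  have h3 : ContDiffAt ℝ k
      (fun p : E × (V →L[ℝ] E) => (T ∘L (fderiv ℝ Φ p.1 ∘L p.2)).inverse) p := by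
    have h4 : ContDiffAt ℝ k (fun p : E × (V →L[ℝ] E) => T ∘L (fderiv ℝ Φ p.1 ∘L p.2)) p :=
      contDiffAt_const.clm_comp h2
    have h5 : ContDiffAt ℝ k ContinuousLinearMap.inverse (T ∘L (fderiv ℝ Φ p.1 ∘L p.2)) :=
      he ▸ contDiffAt_map_inverse e
    exact h5.comp p h4
  exact h1.prodMk (h2.clm_comp h3)

/-- Differentiating `σ ∘ g = Φ ∘ σ` for the transition `g = T ∘ Φ ∘ σ` gives `dσ ∘ dg = dΦ ∘ dσ`.
Here `dg` is injective because `T ∘ Ψ ∘ Φ ∘ σ` is the identity, so one can solve for `dσ` at the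
image point. -/
theorem IsGraphOver.exists_fderiv_transition [FiniteDimensional ℝ V] (h : IsGraphOver X T B W σ)
    (hσ : DifferentiableOn ℝ σ B) {w : V} {Φ Ψ : E → E} (hΦ : DifferentiableAt ℝ Φ (σ w))
    (hΨ : DifferentiableAt ℝ Ψ (Φ (σ w)))
    (hev : ∀ᶠ w in 𝓝 w, w ∈ B ∧ T (Φ (σ w)) ∈ B ∧ σ (T (Φ (σ w))) = Φ (σ w) ∧
      Ψ (Φ (σ w)) = σ w) :
    ∃ e : V ≃L[ℝ] V, (e : V →L[ℝ] V) = T ∘L (fderiv ℝ Φ (σ w) ∘L fderiv ℝ σ w) ∧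
      prolongMap T Φ (prolong σ w) = prolong σ (T (Φ (σ w))) := by
  have hd : ∀ y ∈ B, HasFDerivAt σ (fderiv ℝ σ y) y := fun y hy =>
    ((hσ y hy).differentiableAt (h.isOpen_base.mem_nhds hy)).hasFDerivAt
  obtain ⟨hw, hgB, hw', -⟩ := hev.self_of_nhds
  have hf : HasFDerivAt (fun w => Φ (σ w)) (fderiv ℝ Φ (σ w) ∘L fderiv ℝ σ w) w :=
    hΦ.hasFDerivAt.comp w (hd w hw)
  have hg : HasFDerivAt (fun w => T (Φ (σ w))) (T ∘L (fderiv ℝ Φ (σ w) ∘L fderiv ℝ σ w)) w :=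
    T.hasFDerivAt.comp w hf
  have hfg : fderiv ℝ σ (T (Φ (σ w))) ∘L (T ∘L (fderiv ℝ Φ (σ w) ∘L fderiv ℝ σ w)) =
      fderiv ℝ Φ (σ w) ∘L fderiv ℝ σ w := by
    refine ((hd _ hgB).comp w hg).unique (hf.congr_of_eventuallyEq ?_)
    filter_upwards [hev] with y hy using hy.2.2.1
  have hid : (T ∘L fderiv ℝ Ψ (Φ (σ w))) ∘L (fderiv ℝ Φ (σ w) ∘L fderiv ℝ σ w) = .id ℝ V := by
    refine ((T.hasFDerivAt.comp _ hΨ.hasFDerivAt).comp w hf).unique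
      ((hasFDerivAt_id w).congr_of_eventuallyEq ?_)
    filter_upwards [hev] with y hy
    change T (Ψ (Φ (σ y))) = y
    rw [hy.2.2.2, h.proj y hy.1]
  have hinj : Function.Injective (T ∘L (fderiv ℝ Φ (σ w) ∘L fderiv ℝ σ w)) := by
    refine (injective_iff_map_eq_zero _).2 fun v hv => ?_
    have h1 := DFunLike.congr_fun hfg v
    rw [ContinuousLinearMap.comp_apply, hv, map_zero] at h1
    have h2 := DFunLike.congr_fun hid v
    rw [ContinuousLinearMap.comp_apply, ← h1, map_zero] at h2
    exact h2.symm
  let e : V ≃L[ℝ] V := (LinearEquiv.ofInjectiveEndo (T ∘L (fderiv ℝ Φ (σ w) ∘L fderiv ℝ σ w) :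
    V →L[ℝ] V).toLinearMap hinj).toContinuousLinearEquiv
  have he : (e : V →L[ℝ] V) = T ∘L (fderiv ℝ Φ (σ w) ∘L fderiv ℝ σ w) := by ext v; rfl
  refine ⟨e, he, Prod.ext hw'.symm ?_⟩
  change (fderiv ℝ Φ (σ w) ∘L fderiv ℝ σ w) ∘L
    (T ∘L (fderiv ℝ Φ (σ w) ∘L fderiv ℝ σ w)).inverse = fderiv ℝ σ (T (Φ (σ w)))
  rw [← he] at hfg ⊢
  rw [ContinuousLinearMap.inverse_equiv, ← hfg]
  ext v
  simp

theorem IsGraphOver.eventually_prolongMap [FiniteDimensional ℝ V] (h : IsGraphOver X T B W σ)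
    (hσ : DifferentiableOn ℝ σ B) {k : ℕ} {y z : V} (hy : y ∈ B) {Φ Ψ : E → E}
    (hΦ : ContDiffAt ℝ (k + 1 : ℕ) Φ (σ y)) (hΨ : ContDiffAt ℝ (k + 1 : ℕ) Ψ (σ z))
    (hyz : Φ (σ y) = σ z)
    (hev : ∀ᶠ w in 𝓝 y, w ∈ B ∧ T (Φ (σ w)) ∈ B ∧ σ (T (Φ (σ w))) = Φ (σ w) ∧
      Ψ (Φ (σ w)) = σ w) :
    ContDiffAt ℝ k (prolongMap T Φ) (prolong σ y) ∧
      ∀ᶠ w in 𝓝 y, prolongMap T Φ (prolong σ w) = prolong σ (T (Φ (σ w))) := by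
  have hΦd : ∀ᶠ w in 𝓝 y, DifferentiableAt ℝ Φ (σ w) := by
    refine (h.continuousAt hy).tendsto.eventually ?_
    filter_upwards [hΦ.eventually (by simp)] with x hx using hx.differentiableAt (by simp)
  have hΨd : ∀ᶠ w in 𝓝 y, DifferentiableAt ℝ Ψ (Φ (σ w)) := by
    have hc : ContinuousAt (fun w => Φ (σ w)) y := ContinuousAt.comp hΦ.continuousAt
      (h.continuousAt hy)
    refine hc.tendsto.eventually ?_
    rw [hyz]
    filter_upwards [hΨ.eventually (by simp)] with x hx using hx.differentiableAt (by simp)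
  have hall : ∀ᶠ w in 𝓝 y,
      ∃ e : V ≃L[ℝ] V, (e : V →L[ℝ] V) = T ∘L (fderiv ℝ Φ (σ w) ∘L fderiv ℝ σ w) ∧
      prolongMap T Φ (prolong σ w) = prolong σ (T (Φ (σ w))) := by
    filter_upwards [hΦd, hΨd, eventually_eventually_nhds.2 hev] with w h1 h2 h3
    exact h.exists_fderiv_transition hσ h1 h2 h3
  obtain ⟨e, he, -⟩ := hall.self_of_nhds
  have := FiniteDimensional.complete ℝ V
  exact ⟨contDiffAt_prolongMap hΦ he, hall.mono fun w ⟨_, _, hw⟩ => hw⟩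

/-- The parameter is recovered continuously from the prolonged point by `T` on the first component.
-/
theorem IsGraphOver.eventually_nhdsWithin_prolong (h : IsGraphOver X T B W σ) {y : V}
    (hy : y ∈ B) {P : E × (V →L[ℝ] E) → Prop} (hP : ∀ᶠ w in 𝓝 y, P (prolong σ w)) :
    ∀ᶠ p in 𝓝[prolong σ '' B] (prolong σ y), P p := by
  have ht : Tendsto (fun p : E × (V →L[ℝ] E) => T p.1) (𝓝[prolong σ '' B] (prolong σ y))
      (𝓝 y) := by
    have hc : Continuous (fun p : E × (V →L[ℝ] E) => T p.1) := by fun_prop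
    have := (hc.tendsto (prolong σ y)).mono_left (nhdsWithin_le_nhds (s := prolong σ '' B))
    rwa [show T (prolong σ y).1 = y from h.proj y hy] at this
  filter_upwards [ht.eventually hP, self_mem_nhdsWithin] with p hp hpB
  obtain ⟨w, hw, rfl⟩ := hpB
  rwa [show T (prolong σ w).1 = w from h.proj w hw] at hp

/-- Homogeneity passes to the first order prolongation, at the cost of one derivative. -/
theorem IsGraphOver.germHomogeneous_prolong [FiniteDimensional ℝ V] (h : IsGraphOver X T B W σ)
    (hσ : DifferentiableOn ℝ σ B) {k : ℕ} (hX : GermHomogeneous (k + 1) X) :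
    GermHomogeneous k (prolong σ '' B) := by
  rintro _ ⟨y, hy, rfl⟩ _ ⟨z, hz, rfl⟩
  obtain ⟨Φ, Ψ, h1, h2, h3, h4, h5, h6⟩ := h.exists_transition hX hy hz
  obtain ⟨hc1, he1⟩ := h.eventually_prolongMap hσ hy h1 h2 h3 h5
  obtain ⟨hc2, he2⟩ := h.eventually_prolongMap hσ hz h2 h1 h4 h6
  have aux : ∀ {y z : V} {Φ Ψ : E → E}, y ∈ B → z ∈ B → ContinuousAt Φ (σ y) → Φ (σ y) = σ z →
      (∀ᶠ w in 𝓝 y, w ∈ B ∧ T (Φ (σ w)) ∈ B ∧ σ (T (Φ (σ w))) = Φ (σ w) ∧ Ψ (Φ (σ w)) = σ w) →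
      (∀ᶠ w in 𝓝 y, prolongMap T Φ (prolong σ w) = prolong σ (T (Φ (σ w)))) →
      (∀ᶠ w in 𝓝 z, prolongMap T Ψ (prolong σ w) = prolong σ (T (Ψ (σ w)))) →
      prolongMap T Φ (prolong σ y) = prolong σ z ∧
      ∀ᶠ p in 𝓝[prolong σ '' B] (prolong σ y), prolongMap T Φ p ∈ prolong σ '' B ∧
        prolongMap T Ψ (prolongMap T Φ p) = p := by
    intro y z Φ Ψ hy hz hΦ hyz hev hP hP'
    have ht : Tendsto (fun w => T (Φ (σ w))) (𝓝 y) (𝓝 z) := by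
      have := (h.continuousAt_transition hy hΦ).tendsto
      rwa [hyz, h.proj z hz] at this
    refine ⟨by rw [hP.self_of_nhds, hyz, h.proj z hz], h.eventually_nhdsWithin_prolong hy ?_⟩
    filter_upwards [hev, hP, ht.eventually hP'] with w e1 e2 e3
    rw [e2]
    refine ⟨mem_image_of_mem _ e1.2.1, ?_⟩
    rw [e3, e1.2.2.1, e1.2.2.2, h.proj w e1.1]
  obtain ⟨a1, a2⟩ := aux hy hz h1.continuousAt h3 h5 he1 he2
  obtain ⟨b1, b2⟩ := aux hz hy h2.continuousAt h4 h6 he2 he1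
  exact ⟨prolongMap T Φ, prolongMap T Ψ, hc1, hc2, a1, b1, a2, b2⟩

theorem IsGraphOver.locallyCompactSpace_prolong [FiniteDimensional ℝ V]
    (h : IsGraphOver X T B W σ) (hc : ContinuousOn (prolong σ) B) :
    LocallyCompactSpace (prolong σ '' B) := by
  have := FiniteDimensional.proper ℝ V
  have := h.isOpen_base.locallyCompactSpace
  let f : B ≃ₜ prolong σ '' B :=
    { toFun := fun y => ⟨prolong σ y, mem_image_of_mem _ y.2⟩
      invFun := fun p => ⟨T p.1.1, by
        obtain ⟨y, hy, hp⟩ := p.2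
        rw [← hp, show T (prolong σ y).1 = y from h.proj y hy]
        exact hy⟩
      left_inv := fun y => Subtype.ext (h.proj y y.2)
      right_inv := fun p => by
        obtain ⟨_, y, hy, rfl⟩ := p
        exact Subtype.ext (congrArg (prolong σ) (h.proj y hy))
      continuous_toFun := (continuousOn_iff_continuous_domRestrict.1 hc).subtype_mk _
      continuous_invFun := by
        refine Continuous.subtype_mk ?_ _
        fun_prop }
  exact f.symm.isClosedEmbedding.locallyCompactSpace

theorem IsGraphOver.restrict (h : IsGraphOver X T B W σ) {B' : Set V} (hB' : IsOpen B')
    (hne : B'.Nonempty) (hsub : B' ⊆ B) : IsGraphOver X T B' (W ∩ T ⁻¹' B') σ where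
  isOpen_base := hB'
  nonempty_base := hne
  isOpen_nhd := h.isOpen_nhd.inter (hB'.preimage T.continuous)
  continuousOn := h.continuousOn.mono hsub
  proj := fun y hy => h.proj y (hsub hy)
  mem := fun y hy => ⟨(h.mem y (hsub hy)).1, (h.mem y (hsub hy)).2, by
    rw [mem_preimage, h.proj y (hsub hy)]; exact hy⟩
  param := fun x hx => ⟨hx.2.2, (h.param x ⟨hx.1, hx.2.1⟩).2⟩

/-- If the prolongation is a `C^k` graph over some base, then the parametrization is `C^{k+1}`
somewhere. -/
theorem IsGraphOver.exists_contDiffOn_succ [FiniteDimensional ℝ V] {U : Type*}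
    [NormedAddCommGroup U] [NormedSpace ℝ U] [FiniteDimensional ℝ U]
    (h : IsGraphOver X T B W σ) (hσ : ContDiffOn ℝ 1 σ B) (hc : ContinuousOn (prolong σ) B)
    {k : ℕ} (hk : 1 ≤ k)
    {T' : E × (V →L[ℝ] E) →L[ℝ] U} {B' : Set U} {W' : Set (E × (V →L[ℝ] E))}
    {τ : U → E × (V →L[ℝ] E)} (h' : IsGraphOver (prolong σ '' B) T' B' W' τ)
    (hτ : ContDiffOn ℝ k τ B') :
    ∃ B₁ ⊆ B, IsOpen B₁ ∧ B₁.Nonempty ∧ ContDiffOn ℝ (k + 1 : ℕ) σ B₁ := by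
  have hk0 : ((k : ℕ) : WithTop ℕ∞) ≠ 0 := by
    exact_mod_cast (show k ≠ 0 by omega)
  let f : U → V := fun u => T (τ u).1
  have hfB : ∀ u ∈ B', f u ∈ B ∧ prolong σ (f u) = τ u := fun u hu => by
    obtain ⟨y, hy, hyu⟩ := (h'.mem u hu).1
    have : f u = y := by
      change T (τ u).1 = y
      rw [← hyu]; exact h.proj y hy
    rw [this]
    exact ⟨hy, hyu⟩
  have hf : ContDiffOn ℝ k f B' := T.contDiff.comp_contDiffOn hτ.fst
  have hinj : InjOn f B' := fun u hu w hw huw => by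
    have : τ u = τ w := by rw [← (hfB u hu).2, ← (hfB w hw).2, huw]
    rw [← h'.proj u hu, ← h'.proj w hw, this]
  -- The inverse of `f` is `T' ∘ prolong σ`, which is continuous, so `f '' O` is a preimage of an
  -- open set.
  have hopen : ∀ O ⊆ B', IsOpen O → IsOpen (f '' O) := fun O hO hOo => by
    have : f '' O = B ∩ prolong σ ⁻¹' (W' ∩ T' ⁻¹' O) := by
      ext y
      constructor
      · rintro ⟨u, hu, rfl⟩
        refine ⟨(hfB u (hO hu)).1, ?_⟩
        rw [mem_preimage, (hfB u (hO hu)).2]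
        refine ⟨(h'.mem u (hO hu)).2, ?_⟩
        rw [mem_preimage, h'.proj u (hO hu)]
        exact hu
      · rintro ⟨hy, hyW, hyO⟩
        refine ⟨T' (prolong σ y), hyO, ?_⟩
        change T (τ (T' (prolong σ y))).1 = y
        rw [(h'.param _ ⟨mem_image_of_mem _ hy, hyW⟩).2]
        exact h.proj y hy
    rw [this]
    exact hc.isOpen_inter_preimage h.isOpen_base
      (h'.isOpen_nhd.inter (hOo.preimage T'.continuous))
  obtain ⟨u, hu, e, he⟩ := exists_equiv_fderiv h'.isOpen_base h'.nonempty_base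
    (hf.of_le (by exact_mod_cast hk)) hinj hopen
  have hfu := hf.contDiffAt (h'.isOpen_base.mem_nhds hu)
  have := FiniteDimensional.complete ℝ U
  let g := hfu.localInverse he hk0
  have hg : ContDiffAt ℝ k g (f u) := hfu.to_localInverse he hk0
  have hgu : g (f u) = u := hfu.localInverse_apply_image he hk0
  have hgr : ∀ᶠ y in 𝓝 (f u), f (g y) = y := (hfu.hasStrictFDerivAt' he hk0).eventually_right_inverse
  have hτu := hτ.contDiffAt (h'.isOpen_base.mem_nhds hu)
  have hgB : ∀ᶠ y in 𝓝 (f u), g y ∈ B' := by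
    have ht := hg.continuousAt.tendsto
    rw [hgu] at ht
    exact ht.eventually (h'.isOpen_base.mem_nhds hu)
  have hp : ContDiffAt ℝ k (prolong σ) (f u) := by
    have h1 : ContDiffAt ℝ k (τ ∘ g) (f u) := by
      refine ContDiffAt.comp (f u) ?_ hg
      rwa [hgu]
    refine h1.congr_of_eventuallyEq ?_
    filter_upwards [hgr, hgB] with y h2 h3
    have := (hfB _ h3).2
    rw [h2] at this
    exact this
  have hev : ∀ᶠ y in 𝓝 (f u), ContDiffAt ℝ k (fderiv ℝ σ) y ∧ y ∈ B :=
    Filter.Eventually.and (hp.snd.eventually (by simp)) (h.isOpen_base.mem_nhds (hfB u hu).1)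
  obtain ⟨B₁, hB₁, hB₁o, huB⟩ := eventually_nhds_iff.1 hev
  refine ⟨B₁, fun y hy => (hB₁ y hy).2, hB₁o, ⟨_, huB⟩, ?_⟩
  rw [Nat.cast_add, Nat.cast_one, contDiffOn_succ_iff_fderiv_of_isOpen hB₁o]
  exact ⟨(hσ.mono fun y hy => (hB₁ y hy).2).differentiableOn (by norm_num), by simp,
    fun y hy => (hB₁ y hy).1.contDiffWithinAt⟩

end Prolongation

/-! ### Induction on the order of differentiability -/

/-- A nonempty locally compact `C^k` homogeneous set is somewhere a `C^k` graph. -/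
theorem GermHomogeneous.exists_graph {k : ℕ} (hk : 1 ≤ k) {E : Type*} [NormedAddCommGroup E]
    [NormedSpace ℝ E] [FiniteDimensional ℝ E] {X : Set E} (hlc : LocallyCompactSpace X)
    (hne : X.Nonempty) (hX : GermHomogeneous k X) :
    ∃ (m : ℕ) (T : E →L[ℝ] EuclideanSpace ℝ (Fin m)) (B : Set (EuclideanSpace ℝ (Fin m)))
      (W : Set E) (σ : EuclideanSpace ℝ (Fin m) → E),
      IsGraphOver X T B W σ ∧ ContDiffOn ℝ k σ B := by
  induction k, hk using Nat.le_induction generalizing E with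
  | base => exact_mod_cast hX.exists_graph_one hne
  | succ k hk ih =>
    obtain ⟨m, T, B, W, σ, h, hσ⟩ := (hX.mono (by omega)).exists_graph_one hne
    have hc : ContinuousOn (prolong σ) B :=
      hσ.continuousOn.prodMk (hσ.continuousOn_fderiv_of_isOpen h.isOpen_base le_rfl)
    obtain ⟨m', T', B', W', τ, h', hτ⟩ := ih (h.locallyCompactSpace_prolong hc)
      (h.nonempty_base.image _) (h.germHomogeneous_prolong (hσ.differentiableOn (by norm_num)) hX)
    obtain ⟨B₁, hB₁, hB₁o, hB₁n, hσ₁⟩ := h.exists_contDiffOn_succ hσ hc hk h' hτ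
    exact ⟨m, T, B₁, _, σ, h.restrict hB₁o hB₁n hB₁, hσ₁⟩

/-! ### Straightening a graph to a coordinate slice -/

section Slice

/-- The isometric inclusion of `ℝ^m` in `ℝ^d` as the first `m` coordinates. -/
noncomputable def coordinateInclusion {m d : ℕ} (hmd : m ≤ d) :
    EuclideanSpace ℝ (Fin m) →ₗᵢ[ℝ] EuclideanSpace ℝ (Fin d) where
  toFun u := WithLp.toLp 2 fun i => if h : (i : ℕ) < m then u ⟨i, h⟩ else 0
  map_add' u v := by
    ext i
    by_cases h : (i : ℕ) < m <;> simp [h]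
  map_smul' c u := by
    ext i
    by_cases h : (i : ℕ) < m <;> simp [h]
  norm_map' u := by
    simp only [LinearMap.coe_mk, AddHom.coe_mk]
    rw [EuclideanSpace.norm_eq, EuclideanSpace.norm_eq]
    congr 1
    symm
    refine Finset.sum_of_injOn (Fin.castLE hmd) (Fin.castLE_injective hmd).injOn
      (fun _ _ => Finset.mem_coe.2 (Finset.mem_univ _)) (fun i _ hi => ?_) (fun i _ => ?_)
    · have h : ¬ (i : ℕ) < m := fun h =>
        hi ⟨⟨i, h⟩, Finset.mem_coe.2 (Finset.mem_univ _), Fin.ext rfl⟩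
      simp [h]
    · simp

theorem range_coordinateInclusion {m d : ℕ} (hmd : m ≤ d) :
    range (coordinateInclusion hmd) = coordinateSlice d m := by
  ext v
  constructor
  · rintro ⟨u, rfl⟩ i hi
    simp [coordinateInclusion, not_lt.2 hi]
  · intro hv
    refine ⟨WithLp.toLp 2 fun j => v (Fin.castLE hmd j), ?_⟩
    ext i
    by_cases h : (i : ℕ) < m
    · simp [coordinateInclusion, h]
    · simp [coordinateInclusion, h, hv i (not_lt.1 h)]

/-- Any `m`-dimensional subspace of `ℝ^d` is carried to the coordinate subspace by a linear
isomorphism. -/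
theorem exists_equiv_coordinateSlice {m d : ℕ}
    (R : Submodule ℝ (EuclideanSpace ℝ (Fin d))) (hR : Module.finrank ℝ R = m) :
    ∃ Λ : EuclideanSpace ℝ (Fin d) ≃L[ℝ] EuclideanSpace ℝ (Fin d),
      ∀ x, Λ x ∈ coordinateSlice d m ↔ x ∈ R := by
  have hmd : m ≤ d := by
    rw [← hR]
    exact (Submodule.finrank_le R).trans (by simp)
  let b : R ≃ₗᵢ[ℝ] EuclideanSpace ℝ (Fin m) :=
    ((stdOrthonormalBasis ℝ R).reindex (finCongr hR)).repr
  let L : R →ₗᵢ[ℝ] EuclideanSpace ℝ (Fin d) := (coordinateInclusion hmd).comp b.toLinearIsometry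
  let Λ := (L.extend.toLinearIsometryEquiv rfl).toContinuousLinearEquiv
  have hΛ : ∀ r : R, Λ r = coordinateInclusion hmd (b r) := fun r => L.extend_apply r
  refine ⟨Λ, fun x => ⟨fun hx => ?_, fun hx => ?_⟩⟩
  · rw [← range_coordinateInclusion hmd] at hx
    obtain ⟨u, hu⟩ := hx
    have h1 := hΛ (b.symm u)
    rw [b.apply_symm_apply, hu] at h1
    rw [← Λ.injective h1]
    exact (b.symm u).2
  · rw [← range_coordinateInclusion hmd, show Λ x = _ from hΛ ⟨x, hx⟩]
    exact mem_range_self _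

/-- A `C^k` graph in `ℝ^d` can be straightened to a coordinate subspace. -/
theorem IsGraphOver.exists_straightening {d m k : ℕ} (hk : 1 ≤ k)
    {X : Set (EuclideanSpace ℝ (Fin d))}
    {T : EuclideanSpace ℝ (Fin d) →L[ℝ] EuclideanSpace ℝ (Fin m)}
    {B : Set (EuclideanSpace ℝ (Fin m))} {W : Set (EuclideanSpace ℝ (Fin d))}
    {σ : EuclideanSpace ℝ (Fin m) → EuclideanSpace ℝ (Fin d)} (h : IsGraphOver X T B W σ)
    (hσ : ContDiffOn ℝ k σ B) :
    m ≤ d ∧ ∃ θ : OpenPartialHomeomorph (EuclideanSpace ℝ (Fin d)) (EuclideanSpace ℝ (Fin d)),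
      ContDiffOn ℝ k θ θ.source ∧ ContDiffOn ℝ k θ.symm θ.target ∧ (X ∩ θ.source).Nonempty ∧
      ∀ x ∈ θ.source, θ x ∈ coordinateSlice d m ↔ x ∈ X := by
  obtain ⟨y₀, hy₀⟩ := h.nonempty_base
  let S := fderiv ℝ σ y₀
  have hTS : ∀ u, T (S u) = u := fun u => by
    have h1 : HasFDerivAt σ S y₀ := ((hσ.contDiffAt (h.isOpen_base.mem_nhds hy₀)).differentiableAt
      (by exact_mod_cast (show k ≠ 0 by omega))).hasFDerivAt
    have h2 : T ∘L S = .id ℝ _ := by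
      refine (T.hasFDerivAt.comp y₀ h1).unique ((hasFDerivAt_id y₀).congr_of_eventuallyEq ?_)
      filter_upwards [h.isOpen_base.mem_nhds hy₀] with w hw using h.proj w hw
    exact DFunLike.congr_fun h2 u
  have hSinj : Function.Injective S.toLinearMap := fun u v huv => by
    rw [← hTS u, ← hTS v]
    exact congrArg T huv
  have hrank : Module.finrank ℝ (LinearMap.range S.toLinearMap) = m := by
    rw [LinearMap.finrank_range_of_inj hSinj]
    simp
  obtain ⟨Λ, hΛ⟩ := exists_equiv_coordinateSlice _ hrank
  refine ⟨by rw [← hrank]; exact (Submodule.finrank_le _).trans (by simp), ?_⟩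
  -- A shear along the fibres of `T`: it preserves `T` and replaces the graph of `σ` by the range of
  -- its derivative `S`, with inverse `g` over `B`.
  let f : EuclideanSpace ℝ (Fin d) → EuclideanSpace ℝ (Fin d) := fun x => x - σ (T x) + S (T x)
  let g : EuclideanSpace ℝ (Fin d) → EuclideanSpace ℝ (Fin d) := fun x => x + σ (T x) - S (T x)
  have hTf : ∀ x, T x ∈ B → T (f x) = T x := fun x hx => by
    simp only [f, map_add, map_sub, h.proj _ hx, hTS]
    abel
  have hTg : ∀ x, T x ∈ B → T (g x) = T x := fun x hx => by
    simp only [g, map_add, map_sub, h.proj _ hx, hTS]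
    abel
  have hgf : ∀ x, T x ∈ B → g (f x) = x := fun x hx => by
    simp only [g, hTf x hx]
    simp only [f]
    abel
  have hfg : ∀ x, T x ∈ B → f (g x) = x := fun x hx => by
    simp only [f, hTg x hx]
    simp only [g]
    abel
  have hσT : ContDiffOn ℝ k (fun x => σ (T x)) (T ⁻¹' B) :=
    hσ.comp T.contDiff.contDiffOn fun x hx => hx
  have hf : ContDiffOn ℝ k f (T ⁻¹' B) :=
    (contDiffOn_id.sub hσT).add (S.contDiff.comp T.contDiff).contDiffOn
  have hg : ContDiffOn ℝ k g (T ⁻¹' B) :=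
    (contDiffOn_id.add hσT).sub (S.contDiff.comp T.contDiff).contDiffOn
  have hTB : IsOpen (T ⁻¹' B) := h.isOpen_base.preimage T.continuous
  let s := T ⁻¹' B ∩ W
  let t := Λ.symm ⁻¹' (T ⁻¹' B ∩ g ⁻¹' W)
  have hf' : ContDiffOn ℝ k (fun x => Λ (f x)) s :=
    Λ.contDiff.comp_contDiffOn (hf.mono inter_subset_left)
  have hg' : ContDiffOn ℝ k (fun x => g (Λ.symm x)) t :=
    hg.comp Λ.symm.contDiff.contDiffOn fun x hx => hx.1
  let θ : OpenPartialHomeomorph (EuclideanSpace ℝ (Fin d)) (EuclideanSpace ℝ (Fin d)) :=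
    { toFun := fun x => Λ (f x)
      invFun := fun x => g (Λ.symm x)
      source := s
      target := t
      map_source' := fun x hx => by
        change Λ.symm (Λ (f x)) ∈ T ⁻¹' B ∩ g ⁻¹' W
        rw [Λ.symm_apply_apply]
        refine ⟨?_, ?_⟩
        · rw [mem_preimage, hTf x hx.1]; exact hx.1
        · rw [mem_preimage, hgf x hx.1]; exact hx.2
      map_target' := fun x hx => ⟨by
        rw [mem_preimage, hTg _ hx.1]; exact hx.1, hx.2⟩
      left_inv' := fun x hx => by
        rw [Λ.symm_apply_apply, hgf x hx.1]
      right_inv' := fun x hx => by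
        rw [hfg _ hx.1, Λ.apply_symm_apply]
      open_source := hTB.inter h.isOpen_nhd
      open_target := (hg.continuousOn.isOpen_inter_preimage hTB h.isOpen_nhd).preimage
        Λ.symm.continuous
      continuousOn_toFun := hf'.continuousOn
      continuousOn_invFun := hg'.continuousOn }
  refine ⟨θ, hf', hg', ⟨σ y₀, (h.mem y₀ hy₀).1, ?_, (h.mem y₀ hy₀).2⟩, fun x hx => ?_⟩
  · rw [mem_preimage, h.proj y₀ hy₀]; exact hy₀
  · change Λ (f x) ∈ _ ↔ _
    rw [hΛ]
    constructor
    · rintro ⟨u, hu⟩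
      have h1 : T (f x) = u := by rw [← hu]; exact hTS u
      rw [hTf x hx.1] at h1
      have h2 : S u = x - σ (T x) + S (T x) := hu
      rw [h1, right_eq_add, sub_eq_zero] at h2
      rw [h2]
      exact (h.mem u (h1 ▸ hx.1)).1
    · intro hxX
      refine ⟨T x, ?_⟩
      change S (T x) = x - σ (T x) + S (T x)
      rw [(h.param x ⟨hxX, hx.2⟩).2, sub_self, zero_add]

end Slice

/-! ### Passage between the manifold and a chart -/

section Manifold

variable {d : ℕ} {M : Type*} [TopologicalSpace M] [ChartedSpace (EuclideanSpace ℝ (Fin d)) M]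

theorem mem_maximalAtlas_of_contMDiffOn {n : WithTop ℕ∞} [IsManifold (𝓡 d) n M]
    {φ : OpenPartialHomeomorph M (EuclideanSpace ℝ (Fin d))}
    (h : ContMDiffOn (𝓡 d) (𝓡 d) n φ φ.source)
    (h' : ContMDiffOn (𝓡 d) (𝓡 d) n φ.symm φ.target) :
    φ ∈ IsManifold.maximalAtlas (𝓡 d) n M := by
  have key : ∀ f : OpenPartialHomeomorph (EuclideanSpace ℝ (Fin d)) (EuclideanSpace ℝ (Fin d)),
      ContMDiffOn (𝓡 d) (𝓡 d) n f f.source → ContMDiffOn (𝓡 d) (𝓡 d) n f.symm f.target →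
      f ∈ contDiffGroupoid n (𝓡 d) := fun f h1 h2 => by
    rw [contMDiffOn_iff_contDiffOn] at h1 h2
    refine mem_groupoid_of_pregroupoid.2 ⟨?_, ?_⟩
    · simpa [contDiffPregroupoid] using h1
    · simpa [contDiffPregroupoid] using h2
  refine mem_maximalAtlas_iff.2 fun e he => ?_
  have he' : e ∈ IsManifold.maximalAtlas (𝓡 d) n M := IsManifold.subset_maximalAtlas he
  have e1 := contMDiffOn_of_mem_maximalAtlas he'
  have e2 := contMDiffOn_symm_of_mem_maximalAtlas he'
  have h3 : ContMDiffOn (𝓡 d) (𝓡 d) n (φ.symm ≫ₕ e) (φ.symm ≫ₕ e).source :=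
    e1.comp (h'.mono fun x hx => hx.1) fun x hx => hx.2
  have h4 : ContMDiffOn (𝓡 d) (𝓡 d) n (e.symm ≫ₕ φ) (e.symm ≫ₕ φ).source :=
    h.comp (e2.mono fun x hx => hx.1) fun x hx => hx.2
  have hs : (φ.symm ≫ₕ e).symm = e.symm ≫ₕ φ := by
    rw [OpenPartialHomeomorph.trans_symm_eq_symm_trans_symm, OpenPartialHomeomorph.symm_symm]
  have hs' : (e.symm ≫ₕ φ).symm = φ.symm ≫ₕ e := by rw [← hs, OpenPartialHomeomorph.symm_symm]
  refine ⟨key _ h3 ?_, key _ h4 ?_⟩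
  · rw [← OpenPartialHomeomorph.symm_source, hs]
    exact h4
  · rw [← OpenPartialHomeomorph.symm_source, hs']
    exact h3

/-- The inverse chart restricts to an open embedding into `N`. -/
theorem locallyCompactSpace_chart_image {M H : Type*} [TopologicalSpace M] [TopologicalSpace H]
    (e : OpenPartialHomeomorph M H) {N : Set M} (hN : LocallyCompactSpace N) :
    LocallyCompactSpace (e.target ∩ e.symm ⁻¹' N : Set H) := by
  let f : (e.target ∩ e.symm ⁻¹' N : Set H) → N := fun x => ⟨e.symm x, x.2.2⟩
  have hf : Continuous f := (continuousOn_iff_continuous_domRestrict.1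
    (e.symm.continuousOn.mono inter_subset_left)).subtype_mk _
  have hinj : Function.Injective f := fun x y hxy =>
    Subtype.ext (e.symm.injOn x.2.1 y.2.1 (congrArg Subtype.val hxy))
  have hopen : IsOpenMap f := by
    rintro _ ⟨O, hO, rfl⟩
    have : f '' (Subtype.val ⁻¹' O) = Subtype.val ⁻¹' (e.source ∩ e ⁻¹' O) := by
      ext y
      constructor
      · rintro ⟨x, hx, rfl⟩
        refine ⟨e.map_target x.2.1, ?_⟩
        change e (e.symm x) ∈ O
        rw [e.right_inv x.2.1]
        exact hx
      · rintro ⟨hy, hyO⟩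
        refine ⟨⟨e y, e.map_source hy, ?_⟩, hyO, Subtype.ext (e.left_inv hy)⟩
        rw [mem_preimage, e.left_inv hy]
        exact y.2
    rw [this]
    exact (e.isOpen_inter_preimage hO).preimage continuous_subtype_val
  exact (IsOpenEmbedding.of_continuous_injective_isOpenMap hf hinj hopen).locallyCompactSpace

/-- Homogeneity read in a chart. -/
theorem IsCkHomogeneous.germHomogeneous_chart {k : ℕ} [IsManifold (𝓡 d) (k : WithTop ℕ∞) M]
    {N : Set M} (hom : IsCkHomogeneous k d N) {e : OpenPartialHomeomorph M (EuclideanSpace ℝ (Fin d))}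
    (he : e ∈ IsManifold.maximalAtlas (𝓡 d) (k : WithTop ℕ∞) M) :
    GermHomogeneous k (e.target ∩ e.symm ⁻¹' N) := by
  have aux : ∀ {Φ : OpenPartialHomeomorph M M} {p q : EuclideanSpace ℝ (Fin d)},
      p ∈ e.target ∩ e.symm ⁻¹' N → q ∈ e.target ∩ e.symm ⁻¹' N → e.symm p ∈ Φ.source →
      Φ (e.symm p) = e.symm q →
      ContMDiffOn (𝓡 d) (𝓡 d) (k : WithTop ℕ∞) Φ Φ.source →
      (∀ x ∈ Φ.source, x ∈ N → Φ x ∈ N) →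
      ContDiffAt ℝ k (fun x => e (Φ (e.symm x))) p ∧ e (Φ (e.symm p)) = q ∧
        ∀ᶠ x in 𝓝[e.target ∩ e.symm ⁻¹' N] p, e (Φ (e.symm x)) ∈ e.target ∩ e.symm ⁻¹' N ∧
          e (Φ.symm (e.symm (e (Φ (e.symm x))))) = x := by
    intro Φ p q hp hq hpΦ hpq hΦ hΦN
    have hc1 := contMDiffAt_symm_of_mem_maximalAtlas he hp.1
    have hc2 := hΦ.contMDiffAt (Φ.open_source.mem_nhds hpΦ)
    have hqe : Φ (e.symm p) ∈ e.source := by rw [hpq]; exact e.map_target hq.1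
    have hc3 := contMDiffAt_of_mem_maximalAtlas he hqe
    have hc4 : ContMDiffAt (𝓡 d) (𝓡 d) (k : WithTop ℕ∞) (fun x => Φ (e.symm x)) p :=
      ContMDiffAt.comp p hc2 hc1
    refine ⟨contMDiffAt_iff_contDiffAt.1 (ContMDiffAt.comp p hc3 hc4),
      by rw [hpq, e.right_inv hq.1], ?_⟩
    filter_upwards [mem_nhdsWithin_of_mem_nhds
        (hc1.continuousAt.preimage_mem_nhds (Φ.open_source.mem_nhds hpΦ)),
      mem_nhdsWithin_of_mem_nhds
        (hc4.continuousAt.preimage_mem_nhds (e.open_source.mem_nhds hqe)),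
      self_mem_nhdsWithin] with x h1 h2 h3
    refine ⟨⟨e.map_source h2, ?_⟩, ?_⟩
    · rw [mem_preimage, e.left_inv h2]
      exact hΦN _ h1 h3.2
    · rw [e.left_inv h2, Φ.left_inv h1, e.right_inv h3.1]
  intro p hp q hq
  obtain ⟨Φ, h1, h2, h3, h4, h5⟩ := hom _ hp.2 _ hq.2
  have hN1 : ∀ x ∈ Φ.source, x ∈ N → Φ x ∈ N := fun x hx hxN => by
    have : Φ x ∈ Φ '' (Φ.source ∩ N) := ⟨x, ⟨hx, hxN⟩, rfl⟩
    rw [h5] at this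
    exact this.2
  have hN2 : ∀ x ∈ Φ.symm.source, x ∈ N → Φ.symm x ∈ N := fun x hx hxN => by
    have : x ∈ Φ '' (Φ.source ∩ N) := h5 ▸ ⟨hx, hxN⟩
    obtain ⟨y, hy, rfl⟩ := this
    rw [Φ.left_inv hy.1]
    exact hy.2
  have hq' : e.symm q ∈ Φ.target := h2 ▸ Φ.map_source h1
  have hqp : Φ.symm (e.symm q) = e.symm p := by rw [← h2, Φ.left_inv h1]
  obtain ⟨a1, a2, a3⟩ := aux hp hq h1 h2 h3 hN1
  obtain ⟨b1, b2, b3⟩ := aux (Φ := Φ.symm) hq hp hq' hqp h4 hN2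
  exact ⟨_, _, a1, b1, a2, b2, a3, b3⟩

end Manifold

/-! ### Assembly -/

theorem corollary1p3 (k : ℕ) (hk : 1 ≤ k) (d : ℕ)
    {M : Type*} [TopologicalSpace M] [ChartedSpace (EuclideanSpace ℝ (Fin d)) M]
    [IsManifold (𝓡 d) (k : WithTop ℕ∞) M]
    (N : Set M) (hN : LocallyCompactSpace N) (hom : IsCkHomogeneous k d N) :
    IsCkSubmanifold k d N := by
  rcases N.eq_empty_or_nonempty with rfl | ⟨x₀, hx₀⟩
  · exact ⟨0, Nat.zero_le d, fun x hx => absurd hx (notMem_empty x)⟩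
  let e := chartAt (EuclideanSpace ℝ (Fin d)) x₀
  have he : e ∈ IsManifold.maximalAtlas (𝓡 d) (k : WithTop ℕ∞) M :=
    IsManifold.chart_mem_maximalAtlas x₀
  have hx₀e : x₀ ∈ e.source := mem_chart_source _ x₀
  have hne : (e.target ∩ e.symm ⁻¹' N).Nonempty :=
    ⟨e x₀, e.map_source hx₀e, by rw [mem_preimage, e.left_inv hx₀e]; exact hx₀⟩
  obtain ⟨m, T, B, W, σ, hgr, hσ⟩ := (hom.germHomogeneous_chart he).exists_graph hk
    (locallyCompactSpace_chart_image e hN) hne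
  obtain ⟨hmd, θ, hθ, hθ', ⟨z, hz, hzθ⟩, hslice⟩ := hgr.exists_straightening hk hσ
  refine ⟨m, hmd, fun x hx => ?_⟩
  obtain ⟨Φ, h1, h2, h3, h4, h5⟩ := hom x hx (e.symm z) hz.2
  have hψ : ContMDiffOn (𝓡 d) (𝓡 d) (k : WithTop ℕ∞) (e ≫ₕ θ) (e ≫ₕ θ).source :=
    (contMDiffOn_iff_contDiffOn.2 hθ).comp
      ((contMDiffOn_of_mem_maximalAtlas he).mono fun y hy => hy.1) fun y hy => hy.2
  have hψ' : ContMDiffOn (𝓡 d) (𝓡 d) (k : WithTop ℕ∞) (e ≫ₕ θ).symm (e ≫ₕ θ).target :=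
    (contMDiffOn_symm_of_mem_maximalAtlas he).comp
      ((contMDiffOn_iff_contDiffOn.2 hθ').mono fun y hy => hy.1) fun y hy => hy.2
  -- The local diffeomorphism `Φ` carries `x` to the good point `e.symm z`, where `e` followed by
  -- the straightening `θ` is a slice chart. One `m` therefore serves all points.
  refine ⟨Φ ≫ₕ (e ≫ₕ θ), mem_maximalAtlas_of_contMDiffOn
    (hψ.comp (h3.mono fun y hy => hy.1) fun y hy => hy.2)
    (h4.comp (hψ'.mono fun y hy => hy.1) fun y hy => hy.2), ⟨h1, ?_⟩, ?_⟩
  · change Φ x ∈ (e ≫ₕ θ).source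
    rw [h2]
    refine ⟨e.map_target hz.1, ?_⟩
    change e (e.symm z) ∈ θ.source
    rw [e.right_inv hz.1]
    exact hzθ
  · have hmem : ∀ y ∈ (Φ ≫ₕ (e ≫ₕ θ)).source,
        (Φ ≫ₕ (e ≫ₕ θ)) y ∈ coordinateSlice d m ↔ y ∈ N := by
      rintro y ⟨hyΦ, hye, hyθ⟩
      change Φ y ∈ e.source at hye
      change e (Φ y) ∈ θ.source at hyθ
      change y ∈ Φ.source at hyΦ
      change θ (e (Φ y)) ∈ _ ↔ _
      rw [hslice _ hyθ]
      have h6 : Φ y ∈ Φ '' (Φ.source ∩ N) ↔ y ∈ N :=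
        ⟨fun ⟨w, hw, hwy⟩ => Φ.injOn hw.1 hyΦ hwy ▸ hw.2, fun hy => ⟨y, ⟨hyΦ, hy⟩, rfl⟩⟩
      rw [← h6, h5, mem_inter_iff, mem_inter_iff, mem_preimage, e.left_inv hye]
      exact ⟨fun h => ⟨Φ.map_source hyΦ, h.2⟩, fun h => ⟨e.map_source hye, h.2⟩⟩
    ext v
    constructor
    · rintro ⟨y, ⟨hy, hyN⟩, rfl⟩
      exact ⟨(Φ ≫ₕ (e ≫ₕ θ)).map_source hy, (hmem y hy).2 hyN⟩
    · rintro ⟨hv, hvs⟩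
      have hy := (Φ ≫ₕ (e ≫ₕ θ)).map_target hv
      refine ⟨_, ⟨hy, (hmem _ hy).1 ?_⟩, (Φ ≫ₕ (e ≫ₕ θ)).right_inv hv⟩
      rw [(Φ ≫ₕ (e ≫ₕ θ)).right_inv hv]
      exact hvs
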